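/- \textbf{Definitions.} A matrix-sequence is a sequence $\{A_n\}_n$ of complex square matrices of sizes $d_n\to\infty$. For $n\ge 1$, $a:[0,1]\to\mathbb C$ and $f\in L^1([-\pi,\pi])$ let $D_n(a)=\mathrm{diag}_{i=1,\dots,n}\,a(i/n)$ and $T_n(f)=[f_{i-j}]_{i,j=1}^n$, where $f_k=\frac1{2\pi}\int_{-\pi}^{\pi}f(\theta)e^{-\mathrm i k\theta}\,d\theta$. Sequences $\{B_{n,m}\}_n$, $m\in\mathbb N$, form an approximating class of sequences (a.c.s.) for $\{A_n\}_n$ if there are $n_m$, $c(m)$, $\omega(m)$ depending only on $m$, with $c(m),\omega(m)\to0$ as $m\to\infty$, such that for all $m$ and all $n\ge n_m$ one can write $A_n=B_{n,m}+R_{n,m}+E_{n,m}$ with $\operatorname{rank}R_{n,m}\le c(m)d_n$ and $\|E_{n,m}\|\le\omega(m)$ (spectral norm). Let $D=[0,1]\times[-\pi,\pi]$ and let $\kappa:D\to\mathbb C$ be measurable. We write: - $\{A_n\}_n\sim_{\rm GLT}\kappa$ if there are finite sums of locally Toeplitz sequences $B_{n,m}=\sum_{i=1}^{r_m}D_{d_n}(a_{i,m})T_{d_n}(f_{i,m})$,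 with $a_{i,m}$ Riemann integrable on $[0,1]$ and $f_{i,m}\in L^1([-\pi,\pi])$, that form an a.c.s. for $\{A_n\}_n$ and satisfy $\sum_{i}a_{i,m}(x)f_{i,m}(\theta)\to\kappa(x,\theta)$ in measure on $D$ as $m\to\infty$; - $\{A_n\}_n\sim_\sigma\kappa$ if $\frac1{d_n}\sum_{j=1}^{d_n}F(\sigma_j(A_n))\to\frac1{2\pi}\int_DF(|\kappa|)$ for all continuous compactly supported $F:\mathbb R\to\mathbb C$, where $\sigma_j$ are the singular values; - $\{A_n\}_n\sim_\lambda\kappa$ if $\frac1{d_n}\sum_{j=1}^{d_n}F(\lambda_j(A_n))\to\frac1{2\pi}\int_DF(\kappa)$ for all continuous compactly supported $F:\mathbb C\to\mathbb C$, where $\lambda_j$ are the eigenvalues with algebraic multiplicity; - $\{A_n\}_n\sim_{{\rm GLT},\sigma,\lambda}\kappa$ if all three relations hold. For real $\Gamma,B$ and $N\ge1$ let $$H_N^{\rm CW}=-\frac{\Gamma}{2N}\sum_{x,y=1}^N\sigma_3(x)\sigma_3(y)-B\sum_{x=1}^N\sigma_1(x)$$ be the quantum Curie–Weiss Hamiltonian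 on $(\mathbb C^2)^{\otimes N}$, where $\sigma_i(x)$ acts as the Pauli matrix $\sigma_i$ on the $x$-th factor and as the identity elsewhere. Let $\mathrm{Sym}^N(\mathbb C^2)$ be the subspace of vectors invariant under permutations of the $N$ factors. For $s\in\{0,1\}$ let $\bar H_N^{(s)}$ be the $(N+1)\times(N+1)$ tridiagonal matrix whose rows are labelled by $k=s,\dots,s+N$ and whose row $k$ has diagonal entry $-\frac\Gamma2\left(\frac{2k}N-1\right)^2$, entry $-B\sqrt{1-\frac{k-1}N}\sqrt{\frac kN}$ to the left of the diagonal (absent in the first row) and entry $-B\sqrt{1-\frac kN}\sqrt{\frac{k+1}N}$ to the right of the diagonal (absent in the last row). \textbf{Theorem.} Let $\Gamma,B\in\mathbb R$ and put $$\kappa(x,\theta)=-\frac\Gamma2(2x-1)^2-2B\sqrt{x(1-x)}\cos\theta,\qquad (x,\theta)\in[0,1]\times[-\pi,\pi].$$ 1. For every $N\ge1$, the space $\mathrm{Sym}^N(\mathbb C^2)$ has dimension $N+1$, is invariant under $H_N^{\rm CW}/N$, and has an orthonormal basis in which the restriction $\bar H_N^s$ of $H_N^{\rm CW}/N$ is represented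 by the matrix $\bar H_N^{(0)}$. 2. Let $$K_N=-\frac\Gamma2D_{N+1}\big((2x-1)^2\big)-B\,D_{N+1}\big(\sqrt{x(1-x)}\big)T_{N+1}(e^{\mathrm i\theta})-B\,T_{N+1}(e^{-\mathrm i\theta})D_{N+1}\big(\sqrt{x(1-x)}\big).$$ Then $\|\bar H_N^{(s)}-K_N\|\to0$ as $N\to\infty$ for $s=0$ and for $s=1$. 3. $\{\bar H_N^{(0)}\}_N$, $\{\bar H_N^{(1)}\}_N$ and $\{K_N\}_N$ are all $\sim_{{\rm GLT},\sigma,\lambda}\kappa$. -/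

import Mathlib

open Filter Topology MeasureTheory

noncomputable section

namespace CurieWeissGLT

/-! ### Singular value and eigenvalue distribution of matrix-sequences

A matrix-sequence is a family `A n` of square matrices of sizes `d n`, with `d n → ∞`. -/

/-- The spectral norm of a complex matrix. -/
def spectralNorm {n : ℕ} (A : Matrix (Fin n) (Fin n) ℂ) : ℝ :=
  ‖Matrix.toEuclideanCLM (n := Fin n) (𝕜 := ℂ) A‖

/-- `{A n} ∼_σ (f, D)`: for every continuous compactly supported `F : ℝ → ℂ`, the mean of `F` over
the singular values of `A n` tends to the mean of `F (|f|)` over `D`. -/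
def HasSingularValueDistribution (d : ℕ → ℕ) (A : ∀ n, Matrix (Fin (d n)) (Fin (d n)) ℂ)
    (f : ℝ × ℝ → ℂ) (D : Set (ℝ × ℝ)) : Prop :=
  AEMeasurable f (volume.restrict D) ∧
  ∀ F : ℝ → ℂ, Continuous F → HasCompactSupport F →
    Tendsto
      (fun n => (∑ j ∈ Finset.range (d n),
        F ((Matrix.toEuclideanLin (A n)).singularValues j)) / (d n : ℂ))
      atTop (𝓝 (⨍ p in D, F ‖f p‖))

/-- `{A n} ∼_λ (f, D)`: for every continuous compactly supported `F : ℂ → ℂ`, the mean of `F` over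
the eigenvalues of `A n` (counted with algebraic multiplicity) tends to the mean of `F ∘ f`
over `D`. -/
def HasEigenvalueDistribution (d : ℕ → ℕ) (A : ∀ n, Matrix (Fin (d n)) (Fin (d n)) ℂ)
    (f : ℝ × ℝ → ℂ) (D : Set (ℝ × ℝ)) : Prop :=
  AEMeasurable f (volume.restrict D) ∧
  ∀ F : ℂ → ℂ, Continuous F → HasCompactSupport F →
    Tendsto (fun n => ((A n).charpoly.roots.map F).sum / (d n : ℂ))
      atTop (𝓝 (⨍ p in D, F (f p)))

/-- `{B m n}_n`, `m = 0, 1, …`, is an approximating class of sequences (a.c.s.) for `{A n}`. -/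
def IsACS (d : ℕ → ℕ) (B : ℕ → ∀ n, Matrix (Fin (d n)) (Fin (d n)) ℂ)
    (A : ∀ n, Matrix (Fin (d n)) (Fin (d n)) ℂ) : Prop :=
  ∃ (n₀ : ℕ → ℕ) (c ω : ℕ → ℝ), Tendsto c atTop (𝓝 0) ∧ Tendsto ω atTop (𝓝 0) ∧
    ∀ m n, n₀ m ≤ n → ∃ R E : Matrix (Fin (d n)) (Fin (d n)) ℂ,
      A n = B m n + R + E ∧ (R.rank : ℝ) ≤ c m * d n ∧ spectralNorm E ≤ ω m

/-! ### Unilevel scalar GLT sequences -/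

/-- The `k`-th Fourier coefficient `(1/2π) ∫_{-π}^{π} f(θ) e^{-ikθ} dθ`. -/
def fourierCoefficient (f : ℝ → ℂ) (k : ℤ) : ℂ :=
  (1 / (2 * Real.pi)) * ∫ θ in (-Real.pi)..Real.pi,
    f θ * Complex.exp (-(Complex.I * k * θ))

/-- The Toeplitz matrix `T_n(f)` generated by `f`. -/
def toeplitz (n : ℕ) (f : ℝ → ℂ) : Matrix (Fin n) (Fin n) ℂ :=
  Matrix.of fun i j => fourierCoefficient f ((i : ℤ) - (j : ℤ))

/-- The diagonal sampling matrix `D_n(a) = diag (a (i / n))`, `i = 1, …, n`. -/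
def samplingDiag (n : ℕ) (a : ℝ → ℂ) : Matrix (Fin n) (Fin n) ℂ :=
  Matrix.diagonal fun i => a (((i : ℝ) + 1) / n)

/-- Riemann integrability on `[0, 1]`: bounded and almost everywhere continuous. -/
def RiemannIntegrableUnit (a : ℝ → ℂ) : Prop :=
  (∃ C : ℝ, ∀ x ∈ Set.Icc (0 : ℝ) 1, ‖a x‖ ≤ C) ∧
  ∀ᵐ x ∂(volume.restrict (Set.Icc (0 : ℝ) 1)), ContinuousWithinAt a (Set.Icc (0 : ℝ) 1) x

/-- The domain `[0, 1] × [-π, π]` of unilevel GLT symbols. -/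
def gltDomain : Set (ℝ × ℝ) := Set.Icc 0 1 ×ˢ Set.Icc (-Real.pi) Real.pi

/-- The locally Toeplitz matrix `D_n(a) T_n(f)` with weight `a` and generating function `f`. -/
def locallyToeplitz (n : ℕ) (a f : ℝ → ℂ) : Matrix (Fin n) (Fin n) ℂ :=
  samplingDiag n a * toeplitz n f

/-- `{A n} ∼_GLT κ`: the sequence is an a.c.s. limit of finite sums of locally Toeplitz sequences
(with Riemann integrable weights and integrable generating functions) whose symbols
`∑ a(x) f(θ)` converge to `κ` in measure on `[0, 1] × [-π, π]`. -/
def IsGLT (d : ℕ → ℕ) (A : ∀ n, Matrix (Fin (d n)) (Fin (d n)) ℂ) (κ : ℝ × ℝ → ℂ) : Prop :=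
  Tendsto d atTop atTop ∧ AEMeasurable κ (volume.restrict gltDomain) ∧
  ∃ (r : ℕ → ℕ) (a f : ∀ m, Fin (r m) → ℝ → ℂ),
    (∀ m i, RiemannIntegrableUnit (a m i)) ∧
    (∀ m i, IntegrableOn (f m i) (Set.Icc (-Real.pi) Real.pi)) ∧
    TendstoInMeasure (volume.restrict gltDomain)
      (fun m (p : ℝ × ℝ) => ∑ i, a m i p.1 * f m i p.2) atTop κ ∧
    IsACS d (fun m n => ∑ i, locallyToeplitz (d n) (a m i) (f m i)) A

/-- `{A n} ∼_{GLT,σ,λ} κ`. -/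
def IsGLTSigmaLambda (d : ℕ → ℕ) (A : ∀ n, Matrix (Fin (d n)) (Fin (d n)) ℂ)
    (κ : ℝ × ℝ → ℂ) : Prop :=
  IsGLT d A κ ∧ HasSingularValueDistribution d A κ gltDomain ∧
    HasEigenvalueDistribution d A κ gltDomain

/-! ### The quantum Curie–Weiss model -/

/-- The Hilbert space `(ℂ²)^{⊗ N}`, with the product basis indexed by `Fin N → Fin 2`. -/
abbrev SpinSpace (N : ℕ) : Type := EuclideanSpace ℂ (Fin N → Fin 2)

/-- The Pauli matrix `σ₁`. -/
def pauli₁ : Matrix (Fin 2) (Fin 2) ℂ := !![0, 1; 1, 0]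

/-- The Pauli matrix `σ₃`. -/
def pauli₃ : Matrix (Fin 2) (Fin 2) ℂ := !![1, 0; 0, -1]

/-- The operator on `(ℂ²)^{⊗ N}` acting as `P` on site `x` and as the identity elsewhere. -/
def siteOp {N : ℕ} (P : Matrix (Fin 2) (Fin 2) ℂ) (x : Fin N) :
    Matrix (Fin N → Fin 2) (Fin N → Fin 2) ℂ :=
  Matrix.of fun s t => ∏ y, (if y = x then P else 1) (s y) (t y)

/-- The Curie–Weiss Hamiltonian `-(Γ/2N) ∑_{x,y} σ₃(x) σ₃(y) - B ∑_x σ₁(x)`. -/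
def cwHamiltonian (Γ B : ℝ) (N : ℕ) : Matrix (Fin N → Fin 2) (Fin N → Fin 2) ℂ :=
  (-(Γ / (2 * N)) : ℂ) • ∑ x : Fin N, ∑ y : Fin N, siteOp pauli₃ x * siteOp pauli₃ y
    - (B : ℂ) • ∑ x : Fin N, siteOp pauli₁ x

/-- The symmetric subspace `Sym^N(ℂ²)`: vectors invariant under permutations of the `N` factors. -/
def symSubspace (N : ℕ) : Submodule ℂ (SpinSpace N) where
  carrier := {ψ | ∀ (π : Equiv.Perm (Fin N)) (s : Fin N → Fin 2), ψ (fun x => s (π x)) = ψ s}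
  add_mem' := by
    intro φ ψ hφ hψ π s
    simp only [PiLp.add_apply, hφ π s, hψ π s]
  zero_mem' := by
    intro π s
    simp only [PiLp.zero_apply]
  smul_mem' := by
    intro c ψ hψ π s
    simp only [PiLp.smul_apply, hψ π s]

/-- The `(N+1) × (N+1)` tridiagonal matrix with diagonal entries `-(Γ/2)(2k/N - 1)²` and, in the
row labelled by `k`, entries `-B √(1 - (k-1)/N) √(k/N)` to the left and
`-B √(1 - k/N) √((k+1)/N)` to the right of the diagonal. The rows are labelled by
`k = s, s + 1, …, s + N`. -/
def cwTridiag (Γ B : ℝ) (s N : ℕ) : Matrix (Fin (N + 1)) (Fin (N + 1)) ℂ :=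
  Matrix.of fun i j =>
    let k : ℝ := (i : ℝ) + s
    (((if j.val = i.val then -(Γ / 2) * (2 * k / N - 1) ^ 2
      else if j.val + 1 = i.val then -B * √(1 - (k - 1) / N) * √(k / N)
      else if j.val = i.val + 1 then -B * √(1 - k / N) * √((k + 1) / N)
      else 0 : ℝ)) : ℂ)

/-- The matrix `-(Γ/2) D_{N+1}((2x-1)²) - B D_{N+1}(√(1-x)√x) T_{N+1}(e^{iθ})
- B T_{N+1}(e^{-iθ}) D_{N+1}(√(1-x)√x)`. -/
def cwDiagToeplitz (Γ B : ℝ) (N : ℕ) : Matrix (Fin (N + 1)) (Fin (N + 1)) ℂ :=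
  (-(Γ / 2) : ℂ) • samplingDiag (N + 1) (fun x => (((2 * x - 1) ^ 2 : ℝ) : ℂ))
    - (B : ℂ) • (samplingDiag (N + 1) (fun x => ((√(1 - x) * √x : ℝ) : ℂ)) *
        toeplitz (N + 1) (fun θ => Complex.exp (Complex.I * θ)))
    - (B : ℂ) • (toeplitz (N + 1) (fun θ => Complex.exp (-(Complex.I * θ))) *
        samplingDiag (N + 1) (fun x => ((√(1 - x) * √x : ℝ) : ℂ)))

/-- The symbol `-(Γ/2)(2x-1)² - 2B √((1-x)x) cos θ`. -/
def cwSymbol (Γ B : ℝ) (p : ℝ × ℝ) : ℂ :=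
  ((-(Γ / 2) * (2 * p.1 - 1) ^ 2 - 2 * B * √((1 - p.1) * p.1) * Real.cos p.2 : ℝ) : ℂ)

end CurieWeissGLT

end

/-! Put a(x) = -(Γ/2)(2x-1)² and b(x) = -B√(x(1-x)), so that κ = a + 2b cos θ. All three
matrix-sequences are Hermitian and tridiagonal, and their entries are uniformly close to those of
one model matrix, `tridiagModel`, whose row i carries a(xᵢ) on the diagonal and b(xᵢ) on both sides,
with xᵢ = (i+1)/(N+1). A tridiagonal matrix with entries bounded by r has spectral norm at most 3r
(`IsTridiagonal.spectralNorm_le`), so entrywise closeness to the model gives the norm comparison.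
The model is exactly D(a)T(1) + D(b)T(e^{iθ}) + D(b)T(e^{-iθ}), so the a.c.s. can be taken constant
in m, with no low-rank part.

The two distributions are obtained by moments instead of from general GLT theory. The core is
`uniformlySmall_pow_sub_powCoeff`: the (i,j) entry of Aᵖ is uniformly close to the (i-j)-th Fourier
coefficient of (a(xᵢ) + 2b(xᵢ) cos θ)ᵖ. Since b vanishes at 0 and 1, even the boundary rows cause
only a small error. On the diagonal this makes the normalized trace a Riemann sum for the mean of
κᵖ, and Weierstrass approximation passes from powers to continuous functions. Singular values are
treated through A*A = A².

For the Hamiltonian, a permutation-invariant vector depends only on the number of ones in a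
configuration, so the Dicke states form an orthonormal basis. The σ₃ part acts on them by a scalar.
The σ₁ part flips one spin, and counting flips together with the ratio of consecutive binomial
coefficients gives the off-diagonal entries (`cwHamiltonian_dickeBasis`). -/

namespace CurieWeissGLT

/-! ### Tridiagonal matrices -/

/-- A matrix is tridiagonal if its entries vanish off the three central diagonals. -/
def IsTridiagonal {n : ℕ} (A : Matrix (Fin n) (Fin n) ℂ) : Prop :=
  ∀ i j : Fin n, ¬ ((i : ℕ) ≤ j + 1 ∧ (j : ℕ) ≤ i + 1) → A i j = 0

/-- The indices at distance at most one from `i`. -/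
def neighbours {n : ℕ} (i : Fin n) : Finset (Fin n) :=
  Finset.univ.filter fun j => (i : ℕ) ≤ j + 1 ∧ (j : ℕ) ≤ i + 1

theorem mem_neighbours {n : ℕ} {i j : Fin n} :
    j ∈ neighbours i ↔ (i : ℕ) ≤ j + 1 ∧ (j : ℕ) ≤ i + 1 := by
  simp [neighbours]

theorem mem_neighbours_comm {n : ℕ} {i j : Fin n} : j ∈ neighbours i ↔ i ∈ neighbours j := by
  simp only [mem_neighbours]; tauto

theorem card_neighbours_le {n : ℕ} (i : Fin n) : (neighbours i).card ≤ 3 := by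
  -- Shifting indices by one avoids the truncated subtraction `i - 1` at `i = 0`.
  have h : (neighbours i).image (fun j : Fin n => (j : ℕ) + 1) ⊆ Finset.Icc (i : ℕ) (i + 2) := by
    intro k hk
    obtain ⟨j, hj, rfl⟩ := Finset.mem_image.1 hk
    have := mem_neighbours.1 hj
    simp only [Finset.mem_Icc]; omega
  have h2 := Finset.card_le_card h
  rw [Finset.card_image_of_injective _ (fun a b hab => Fin.ext (by simpa using hab))] at h2
  simp only [Nat.card_Icc] at h2
  change (neighbours i).card ≤ _ at h2
  omega

theorem IsTridiagonal.sum_eq {n : ℕ} {A : Matrix (Fin n) (Fin n) ℂ} (hA : IsTridiagonal A)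
    (i : Fin n) (x : Fin n → ℂ) : ∑ j, A i j * x j = ∑ j ∈ neighbours i, A i j * x j := by
  refine (Finset.sum_subset (Finset.subset_univ _) fun j _ hj => ?_).symm
  rw [hA i j (fun h => hj (mem_neighbours.2 h)), zero_mul]

theorem IsTridiagonal.norm_sum_le {n : ℕ} {A : Matrix (Fin n) (Fin n) ℂ} (hA : IsTridiagonal A)
    {i : Fin n} {x : Fin n → ℂ} {r s : ℝ} (hr : ∀ j, ‖A i j‖ ≤ r)
    (hx : ∀ j ∈ neighbours i, ‖x j‖ ≤ s) (hs : 0 ≤ s) :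
    ‖∑ j, A i j * x j‖ ≤ 3 * (r * s) := by
  have hr0 : 0 ≤ r := (norm_nonneg _).trans (hr i)
  rw [hA.sum_eq]
  calc ‖∑ j ∈ neighbours i, A i j * x j‖ ≤ ∑ j ∈ neighbours i, r * s := by
        refine norm_sum_le_of_le _ fun j hj => ?_
        rw [norm_mul]
        exact mul_le_mul (hr j) (hx j hj) (norm_nonneg _) hr0
    _ = (neighbours i).card * (r * s) := by simp
    _ ≤ 3 * (r * s) := by
        gcongr
        exact_mod_cast card_neighbours_le i

theorem IsTridiagonal.sub {n : ℕ} {A B : Matrix (Fin n) (Fin n) ℂ} (hA : IsTridiagonal A)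
    (hB : IsTridiagonal B) : IsTridiagonal (A - B) := fun i j h => by
  rw [Matrix.sub_apply, hA i j h, hB i j h, sub_zero]

/-- One factor √3 comes from Cauchy–Schwarz on the at most three entries of a row, the other from
each coordinate occurring in at most three rows, after exchanging the sums by symmetry of the
neighbour relation. -/
theorem IsTridiagonal.spectralNorm_le {n : ℕ} {A : Matrix (Fin n) (Fin n) ℂ}
    (hA : IsTridiagonal A) {r : ℝ} (hr : 0 ≤ r) (hb : ∀ i j, ‖A i j‖ ≤ r) :
    spectralNorm A ≤ 3 * r := by
  refine ContinuousLinearMap.opNorm_le_bound _ (by positivity) fun x => ?_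
  refine le_of_sq_le_sq ?_ (by positivity)
  rw [mul_pow, EuclideanSpace.norm_sq_eq, EuclideanSpace.norm_sq_eq]
  have row : ∀ i, ‖(Matrix.toEuclideanCLM (n := Fin n) (𝕜 := ℂ) A x) i‖ ^ 2 ≤
      ∑ j ∈ neighbours i, 3 * r ^ 2 * ‖x j‖ ^ 2 := by
    intro i
    have h1 : (Matrix.toEuclideanCLM (n := Fin n) (𝕜 := ℂ) A x) i = ∑ j, A i j * x j := rfl
    rw [h1, hA.sum_eq]
    calc ‖∑ j ∈ neighbours i, A i j * x j‖ ^ 2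
        ≤ (∑ j ∈ neighbours i, r * ‖x j‖) ^ 2 := by
          gcongr
          refine norm_sum_le_of_le _ fun j _ => ?_
          rw [norm_mul]
          gcongr
          exact hb i j
      _ ≤ (neighbours i).card * ∑ j ∈ neighbours i, (r * ‖x j‖) ^ 2 := sq_sum_le_card_mul_sum_sq
      _ ≤ 3 * ∑ j ∈ neighbours i, (r * ‖x j‖) ^ 2 := by
          gcongr
          exact_mod_cast card_neighbours_le i
      _ = _ := by
          rw [Finset.mul_sum]
          exact Finset.sum_congr rfl fun j _ => by ring
  calc ∑ i, ‖(Matrix.toEuclideanCLM (n := Fin n) (𝕜 := ℂ) A x) i‖ ^ 2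
      ≤ ∑ i, ∑ j ∈ neighbours i, 3 * r ^ 2 * ‖x j‖ ^ 2 := Finset.sum_le_sum fun i _ => row i
    _ = ∑ j, ∑ i ∈ neighbours j, 3 * r ^ 2 * ‖x j‖ ^ 2 :=
        Finset.sum_comm' fun i j => by simp [mem_neighbours_comm]
    _ = ∑ j, ((neighbours j).card : ℝ) * (3 * r ^ 2 * ‖x j‖ ^ 2) := by simp
    _ ≤ ∑ j, 3 * (3 * r ^ 2 * ‖x j‖ ^ 2) := by
        gcongr with j
        exact_mod_cast card_neighbours_le j
    _ = (3 * r) ^ 2 * ∑ j, ‖x j‖ ^ 2 := by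
        rw [Finset.mul_sum]
        exact Finset.sum_congr rfl fun j _ => by ring

/-! ### Traces of powers and eigenvalues of Hermitian matrices -/

theorem abs_eigenvalues_le_spectralNorm {n : ℕ} {A : Matrix (Fin n) (Fin n) ℂ}
    (hA : A.IsHermitian) (i : Fin n) : |hA.eigenvalues i| ≤ spectralNorm A := by
  have h := (Matrix.toEuclideanCLM (n := Fin n) (𝕜 := ℂ) A).le_opNorm (hA.eigenvectorBasis i)
  have h2 : Matrix.toEuclideanCLM (n := Fin n) (𝕜 := ℂ) A (hA.eigenvectorBasis i) =
      hA.eigenvalues i • hA.eigenvectorBasis i := by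
    ext j
    exact congrFun (hA.mulVec_eigenvectorBasis i) j
  rw [h2, norm_smul, (hA.eigenvectorBasis).norm_eq_one, mul_one, mul_one, Real.norm_eq_abs] at h
  exact h

theorem trace_pow_eq_sum_eigenvalues {n : Type*} [Fintype n] [DecidableEq n] {A : Matrix n n ℂ}
    (hA : A.IsHermitian) (p : ℕ) : (A ^ p).trace = ∑ i, (hA.eigenvalues i : ℂ) ^ p := by
  conv_lhs => rw [hA.spectral_theorem]
  rw [← map_pow, Unitary.conjStarAlgAut_apply, Matrix.trace_mul_cycle, Unitary.coe_star_mul_self,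
    one_mul, Matrix.diagonal_pow, Matrix.trace_diagonal]
  rfl

theorem sum_map_roots_charpoly {n : Type*} [Fintype n] [DecidableEq n] {A : Matrix n n ℂ}
    (hA : A.IsHermitian) (F : ℂ → ℂ) :
    (A.charpoly.roots.map F).sum = ∑ i, F (hA.eigenvalues i : ℂ) := by
  rw [hA.roots_charpoly_eq_eigenvalues, Multiset.map_map]
  rfl

/-- Squared singular values are the eigenvalues of T*T, and T*T and A*A share a characteristic
polynomial. Comparing the root multisets avoids matching the two enumerations of eigenvalues. -/
theorem sum_singularValues_eq {n : ℕ} (A : Matrix (Fin n) (Fin n) ℂ) (F : ℝ → ℂ) :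
    ∑ j ∈ Finset.range n, F ((Matrix.toEuclideanLin A).singularValues j) =
      ∑ i, F (√((Matrix.isHermitian_conjTranspose_mul_self A).eigenvalues i)) := by
  have hn : Module.finrank ℂ (EuclideanSpace ℂ (Fin n)) = n := by simp
  set T := Matrix.toEuclideanLin A
  have hT := T.isSymmetric_adjoint_comp_self
  have hH := Matrix.isHermitian_conjTranspose_mul_self A
  have hcomp : LinearMap.adjoint T ∘ₗ T = Matrix.toLin
      (EuclideanSpace.basisFun (Fin n) ℂ).toBasis (EuclideanSpace.basisFun (Fin n) ℂ).toBasis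
      (A.conjTranspose * A) := by
    rw [← Matrix.toEuclideanLin_conjTranspose_eq_adjoint, ← Matrix.toEuclideanLin_eq_toLin_orthonormal]
    ext x j
    simp [T, Matrix.toLpLin_apply]
  have h1 := hT.roots_charpoly_eq_eigenvalues hn
  have h2 := hH.roots_charpoly_eq_eigenvalues
  have h0 : (LinearMap.adjoint T ∘ₗ T).charpoly = (A.conjTranspose * A).charpoly := by
    rw [hcomp, Matrix.charpoly_toLin]
  rw [h0, h2] at h1
  have h3 := congrArg (fun s : Multiset ℂ => (s.map fun z => F √z.re).sum) h1
  simp only [Multiset.map_map] at h3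
  rw [← Fin.sum_univ_eq_sum_range fun j => F (T.singularValues j)]
  calc _ = ∑ i, F (√(hT.eigenvalues hn i)) :=
        Finset.sum_congr rfl fun i _ => by rw [T.singularValues_fin hn]
    _ = _ := by
        symm
        simpa [Finset.sum] using h3

/-! ### Convergence of moments and convergence of means -/

theorem norm_sum_div_le {n : ℕ} {x : Fin (n + 1) → ℂ} {r : ℝ} (hx : ∀ i, ‖x i‖ ≤ r) :
    ‖(∑ i, x i) / ((n : ℂ) + 1)‖ ≤ r := by
  have h : ‖(n : ℂ) + 1‖ = (n : ℝ) + 1 := by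
    have := Complex.norm_natCast (n + 1)
    push_cast at this
    exact this
  rw [norm_div, h, div_le_iff₀ (by positivity)]
  refine (norm_sum_le_of_le _ fun i _ => hx i).trans_eq ?_
  simp [mul_comm]

theorem abs_sum_div_le {n : ℕ} {x : Fin (n + 1) → ℝ} {r : ℝ} (hx : ∀ i, |x i| ≤ r) :
    |(∑ i, x i) / ((n : ℝ) + 1)| ≤ r := by
  have := norm_sum_div_le (x := fun i => (x i : ℂ)) (r := r) (by simpa using hx)
  rw [← Real.norm_eq_abs, ← Complex.norm_real]
  push_cast
  exact this

/-- All values lie in the compact interval [-M, M], where F is within ε/3 of a polynomial; the means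
of polynomials converge by linearity from the moments. -/
theorem tendsto_mean_of_moments {α : Type*} [MeasurableSpace α] {μ : Measure α}
    [IsProbabilityMeasure μ] {g : α → ℝ} (hg : AEStronglyMeasurable g μ) {M : ℝ}
    (hgM : ∀ᵐ x ∂μ, |g x| ≤ M) {v : ∀ N : ℕ, Fin (N + 1) → ℝ} (hv : ∀ᶠ N in atTop, ∀ i, |v N i| ≤ M)
    (hm : ∀ p : ℕ, Tendsto (fun N => (∑ i, v N i ^ p) / ((N : ℝ) + 1)) atTop
      (𝓝 (∫ x, g x ^ p ∂μ)))
    {F : ℝ → ℝ} (hF : Continuous F) :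
    Tendsto (fun N => (∑ i, F (v N i)) / ((N : ℝ) + 1)) atTop (𝓝 (∫ x, F (g x) ∂μ)) := by
  have hint : ∀ G : ℝ → ℝ, Continuous G → Integrable (fun x => G (g x)) μ := by
    intro G hG
    obtain ⟨C, hC⟩ := isCompact_Icc.exists_bound_of_continuousOn (s := Set.Icc (-M) M)
      hG.continuousOn
    refine Integrable.of_bound (hG.comp_aestronglyMeasurable hg) C ?_
    filter_upwards [hgM] with x hx using hC _ (abs_le.1 hx)
  have hpoly : ∀ q : Polynomial ℝ, Tendsto (fun N => (∑ i, q.eval (v N i)) / ((N : ℝ) + 1)) atTop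
      (𝓝 (∫ x, q.eval (g x) ∂μ)) := by
    intro q
    simp only [Polynomial.eval_eq_sum_range]
    rw [integral_finsetSum _ fun k _ => (hint (fun t => q.coeff k * t ^ k) (by fun_prop))]
    have h := tendsto_finsetSum (Finset.range (q.natDegree + 1))
      fun k _ => (hm k).const_mul (q.coeff k)
    simp only [integral_const_mul]
    refine h.congr fun N => ?_
    rw [Finset.sum_comm, Finset.sum_div]
    exact Finset.sum_congr rfl fun k _ => by rw [← Finset.mul_sum, mul_div_assoc]
  rw [Metric.tendsto_nhds]
  intro ε hε
  obtain ⟨q, hq⟩ := exists_polynomial_near_of_continuousOn (-M) M F hF.continuousOn (ε / 3)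
    (by positivity)
  filter_upwards [hv, Metric.tendsto_nhds.1 (hpoly q) (ε / 3) (by positivity)] with N hvN h1
  have h2 : |(∑ i, (q.eval (v N i) - F (v N i))) / ((N : ℝ) + 1)| ≤ ε / 3 :=
    abs_sum_div_le fun i => (hq _ (abs_le.1 (hvN i))).le
  have h3 : ‖∫ x, (q.eval (g x) - F (g x)) ∂μ‖ ≤ ε / 3 := by
    refine (norm_integral_le_of_norm_le_const (C := ε / 3) ?_).trans_eq (by simp)
    filter_upwards [hgM] with x hx using (hq _ (abs_le.1 hx)).le
  rw [integral_sub (hint (fun t => q.eval t) (by fun_prop)) (hint F hF), Real.norm_eq_abs] at h3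
  rw [Finset.sum_sub_distrib, sub_div] at h2
  rw [Real.dist_eq] at h1 ⊢
  rw [abs_lt] at h1 ⊢
  rw [abs_le] at h2 h3
  constructor <;> linarith [h1.1, h1.2, h2.1, h2.2, h3.1, h3.2]

theorem tendsto_mean_complex_of_moments {α : Type*} [MeasurableSpace α] {μ : Measure α}
    [IsProbabilityMeasure μ] {g : α → ℝ} (hg : AEStronglyMeasurable g μ) {M : ℝ}
    (hgM : ∀ᵐ x ∂μ, |g x| ≤ M) {v : ∀ N : ℕ, Fin (N + 1) → ℝ} (hv : ∀ᶠ N in atTop, ∀ i, |v N i| ≤ M)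
    (hm : ∀ p : ℕ, Tendsto (fun N => (∑ i, v N i ^ p) / ((N : ℝ) + 1)) atTop
      (𝓝 (∫ x, g x ^ p ∂μ)))
    {F : ℝ → ℂ} (hF : Continuous F) :
    Tendsto (fun N => (∑ i, F (v N i)) / ((N : ℂ) + 1)) atTop (𝓝 (∫ x, F (g x) ∂μ)) := by
  have hint : Integrable (fun x => F (g x)) μ := by
    obtain ⟨C, hC⟩ := isCompact_Icc.exists_bound_of_continuousOn (s := Set.Icc (-M) M)
      hF.continuousOn
    refine Integrable.of_bound (hF.comp_aestronglyMeasurable hg) C ?_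
    filter_upwards [hgM] with x hx using hC _ (abs_le.1 hx)
  have hre := tendsto_mean_of_moments hg hgM hv hm (Complex.continuous_re.comp hF)
  have him := tendsto_mean_of_moments hg hgM hv hm (Complex.continuous_im.comp hF)
  have h := ((Complex.continuous_ofReal.tendsto _).comp hre).add
    (((Complex.continuous_ofReal.tendsto _).comp him).mul_const Complex.I)
  have h1 := integral_re_add_im hint
  simp only [RCLike.re_eq_complex_re, RCLike.im_eq_complex_im, RCLike.I_to_complex,
    Complex.coe_algebraMap] at h1
  convert h using 1
  · funext N
    simp only [Function.comp_def]
    push_cast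
    rw [div_mul_eq_mul_div, ← add_div, Finset.sum_mul, ← Finset.sum_add_distrib]
    congr 1
    exact Finset.sum_congr rfl fun i _ => (Complex.re_add_im _).symm
  · congr 1
    exact h1.symm

/-! ### Riemann sums -/

/-- The sampling point `(i + 1) / (n + 1)`. -/
noncomputable def samplePoint (n : ℕ) (i : ℕ) : ℝ := ((i : ℝ) + 1) / ((n : ℝ) + 1)

theorem samplePoint_mem (n : ℕ) (i : Fin (n + 1)) : samplePoint n i ∈ Set.Icc (0 : ℝ) 1 := by
  have : (i : ℝ) ≤ n := by exact_mod_cast Nat.lt_succ_iff.1 i.2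
  refine ⟨by unfold samplePoint; positivity, ?_⟩
  unfold samplePoint
  rw [div_le_one (by positivity)]
  linarith

/-- Each sample is compared with the average of g over the cell of which it is the right endpoint;
uniform continuity bounds all these errors at once. -/
theorem tendsto_mean_samplePoint {g : ℝ → ℂ} (hg : Continuous g) :
    Tendsto (fun n : ℕ => (∑ i : Fin (n + 1), g (samplePoint n i)) / ((n : ℂ) + 1)) atTop
      (𝓝 (∫ x in (0 : ℝ)..1, g x)) := by
  have huc := isCompact_Icc.uniformContinuousOn_of_continuous (s := Set.Icc (0 : ℝ) 1)
    hg.continuousOn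
  rw [Metric.uniformContinuousOn_iff_le] at huc
  rw [Metric.tendsto_atTop]
  intro ε hε
  obtain ⟨δ, hδ, h⟩ := huc (ε / 2) (by positivity)
  obtain ⟨N₀, hN₀⟩ := exists_nat_gt (1 / δ)
  refine ⟨N₀, fun n hn => ?_⟩
  have hn1 : (0 : ℝ) < (n : ℝ) + 1 := by positivity
  have hnδ : 1 / ((n : ℝ) + 1) ≤ δ := by
    have : (N₀ : ℝ) ≤ n := by exact_mod_cast hn
    rw [div_le_iff₀ hn1]
    rw [div_lt_iff₀ hδ] at hN₀
    nlinarith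
  have hsum := intervalIntegral.sum_integral_adjacent_intervals (f := g) (μ := volume)
    (a := fun k : ℕ => (k : ℝ) / ((n : ℝ) + 1)) (n := n + 1)
    (fun k _ => hg.intervalIntegrable _ _)
  have hend : (((n + 1 : ℕ) : ℝ)) / ((n : ℝ) + 1) = 1 := by
    push_cast; exact div_self hn1.ne'
  simp only [hend, Nat.cast_zero, zero_div] at hsum
  rw [← Fin.sum_univ_eq_sum_range fun k : ℕ =>
    ∫ x in ((k : ℝ) / ((n : ℝ) + 1))..(((k + 1 : ℕ) : ℝ) / ((n : ℝ) + 1)), g x] at hsum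
  have hterm : ∀ i : Fin (n + 1), ‖g (samplePoint n i) -
      ((n : ℂ) + 1) * ∫ x in ((i : ℝ) / ((n : ℝ) + 1))..((((i : ℕ) + 1 : ℕ) : ℝ) / ((n : ℝ) + 1)), g x‖
        ≤ ε / 2 := by
    intro i
    have hlen : (((i : ℕ) + 1 : ℕ) : ℝ) / ((n : ℝ) + 1) - (i : ℝ) / ((n : ℝ) + 1) =
        1 / ((n : ℝ) + 1) := by
      push_cast; ring
    have hn0 : (n : ℂ) + 1 ≠ 0 := Nat.cast_add_one_ne_zero n
    have hconst : g (samplePoint n i) = ((n : ℂ) + 1) *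
        ∫ x in ((i : ℝ) / ((n : ℝ) + 1))..((((i : ℕ) + 1 : ℕ) : ℝ) / ((n : ℝ) + 1)),
          g (samplePoint n i) := by
      rw [intervalIntegral.integral_const, hlen, Complex.real_smul]
      push_cast
      field_simp
    nth_rw 1 [hconst]
    rw [← mul_sub, ← intervalIntegral.integral_sub (by simp) (hg.intervalIntegrable _ _), norm_mul]
    have hb := intervalIntegral.norm_integral_le_of_norm_le_const (C := ε / 2)
      (f := fun x => g (samplePoint n i) - g x) (a := (i : ℝ) / ((n : ℝ) + 1))
      (b := (((i : ℕ) + 1 : ℕ) : ℝ) / ((n : ℝ) + 1)) (by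
        intro x hx
        have hle : (i : ℝ) / ((n : ℝ) + 1) ≤ (((i : ℕ) + 1 : ℕ) : ℝ) / ((n : ℝ) + 1) := by
          gcongr
          simp
        rw [Set.uIoc_of_le hle] at hx
        have hs : samplePoint n i = (((i : ℕ) + 1 : ℕ) : ℝ) / ((n : ℝ) + 1) := by
          simp [samplePoint]
        have hmem := samplePoint_mem n i
        rw [hs] at hmem ⊢
        have h0 : 0 ≤ (i : ℝ) / ((n : ℝ) + 1) := by positivity
        rw [← dist_eq_norm]
        refine h _ hmem x ⟨h0.trans hx.1.le, hx.2.trans hmem.2⟩ ?_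
        rw [Real.dist_eq, abs_of_nonneg (by linarith [hx.2])]
        linarith [hx.1])
    rw [hlen, abs_of_nonneg (by positivity)] at hb
    have hnorm : ‖(n : ℂ) + 1‖ = (n : ℝ) + 1 := by
      have := Complex.norm_natCast (n + 1)
      push_cast at this
      exact this
    rw [hnorm]
    calc _ ≤ ((n : ℝ) + 1) * (ε / 2 * (1 / ((n : ℝ) + 1))) := by gcongr
      _ = ε / 2 := by field_simp
  have key := norm_sum_div_le hterm
  rw [Finset.sum_sub_distrib, ← Finset.mul_sum, hsum, sub_div,
    mul_div_cancel_left₀ _ (Nat.cast_add_one_ne_zero n), ← dist_eq_norm] at key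
  linarith

/-! ### Fourier coefficients of powers of `α + 2 β cos θ` -/

/-- The `k`-th Fourier coefficient of `(α + 2 β cos θ) ^ p`. -/
def powCoeff : ℕ → ℂ → ℂ → ℤ → ℂ
  | 0, _, _, k => if k = 0 then 1 else 0
  | p + 1, α, β, k => α * powCoeff p α β k + β * (powCoeff p α β (k - 1) + powCoeff p α β (k + 1))

theorem norm_powCoeff_le {K : ℝ} {α β : ℂ} (hα : ‖α‖ ≤ K) (hβ : ‖β‖ ≤ K) (p : ℕ) (k : ℤ) :
    ‖powCoeff p α β k‖ ≤ (3 * K) ^ p := by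
  have hK : 0 ≤ K := (norm_nonneg _).trans hα
  induction p generalizing k with
  | zero => rw [powCoeff]; split_ifs <;> simp
  | succ p ih =>
    rw [powCoeff]
    calc _ ≤ ‖α‖ * ‖powCoeff p α β k‖ +
          ‖β‖ * (‖powCoeff p α β (k - 1)‖ + ‖powCoeff p α β (k + 1)‖) := by
          refine (norm_add_le _ _).trans ?_
          rw [norm_mul, norm_mul]
          gcongr
          exact norm_add_le _ _
      _ ≤ K * (3 * K) ^ p + K * ((3 * K) ^ p + (3 * K) ^ p) := by
          gcongr <;> apply ih
      _ = (3 * K) ^ (p + 1) := by ring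

/-- Lipschitz dependence on (α, β), uniform in k. It is what allows the symbol to be frozen at one
sampling point when a row is multiplied out. -/
theorem exists_norm_powCoeff_sub_le {K : ℝ} (hK : 0 ≤ K) (p : ℕ) :
    ∃ L : ℝ, 0 ≤ L ∧ ∀ (α β α' β' : ℂ) (k : ℤ), ‖α‖ ≤ K → ‖β‖ ≤ K → ‖α'‖ ≤ K → ‖β'‖ ≤ K →
      ‖powCoeff p α β k - powCoeff p α' β' k‖ ≤ L * (‖α - α'‖ + ‖β - β'‖) := by
  induction p with
  | zero => exact ⟨0, le_rfl, fun α β α' β' k _ _ _ _ => by simp [powCoeff]⟩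
  | succ p ih =>
    obtain ⟨L, hL, h⟩ := ih
    -- The three terms of the recursion each contribute K·L. The change of β enters through two
    -- shifted coefficients, hence the factor 2.
    refine ⟨3 * K * L + 2 * (3 * K) ^ p, by positivity, fun α β α' β' k hα hβ hα' hβ' => ?_⟩
    have e : powCoeff (p + 1) α β k - powCoeff (p + 1) α' β' k =
        α * (powCoeff p α β k - powCoeff p α' β' k) + (α - α') * powCoeff p α' β' k +
        (β * (powCoeff p α β (k - 1) - powCoeff p α' β' (k - 1)) +
          (β - β') * powCoeff p α' β' (k - 1)) +
        (β * (powCoeff p α β (k + 1) - powCoeff p α' β' (k + 1)) +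
          (β - β') * powCoeff p α' β' (k + 1)) := by
      simp only [powCoeff]; ring
    have t : ∀ (γ δ : ℂ) (l : ℤ), ‖γ‖ ≤ K →
        ‖γ * (powCoeff p α β l - powCoeff p α' β' l) + δ * powCoeff p α' β' l‖ ≤
          K * (L * (‖α - α'‖ + ‖β - β'‖)) + ‖δ‖ * (3 * K) ^ p := by
      intro γ δ l hγ
      refine (norm_add_le _ _).trans ?_
      rw [norm_mul, norm_mul]
      gcongr
      · exact h α β α' β' l hα hβ hα' hβ'
      · exact norm_powCoeff_le hα' hβ' p l
    rw [e]
    have h1 := t α (α - α') k hα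
    have h2 := t β (β - β') (k - 1) hβ
    have h3 := t β (β - β') (k + 1) hβ
    have h4 : 0 ≤ ‖α - α'‖ * (3 * K) ^ p := by positivity
    refine (norm_add₃_le).trans ((add_le_add (add_le_add h1 h2) h3).trans ?_)
    linarith

theorem continuous_powCoeff {a b : ℝ → ℂ} (ha : Continuous a) (hb : Continuous b) (p : ℕ) (k : ℤ) :
    Continuous fun x => powCoeff p (a x) (b x) k := by
  induction p generalizing k with
  | zero => exact continuous_const
  | succ p ih =>
    simp only [powCoeff]
    exact (ha.mul (ih k)).add (hb.mul ((ih _).add (ih _)))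

theorem integral_exp_int_mul (k : ℤ) :
    ∫ θ in (-Real.pi)..Real.pi, Complex.exp (-(Complex.I * k * θ)) =
      if k = 0 then 2 * (Real.pi : ℂ) else 0 := by
  split_ifs with hk
  · subst hk
    simp
    ring
  · have hc : -(Complex.I * k) ≠ 0 := by
      simp [hk]
    have h := integral_exp_mul_complex (a := -Real.pi) (b := Real.pi) hc
    simp only [neg_mul] at h
    rw [h, div_eq_zero_iff]
    left
    -- The exponents at the two endpoints differ by an integer multiple of 2πi.
    have e : Complex.exp (-(Complex.I * k * ((Real.pi : ℝ) : ℂ))) =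
        Complex.exp (-(Complex.I * k * ((-Real.pi : ℝ) : ℂ)) + (-k : ℤ) * (2 * Real.pi * Complex.I)) := by
      congr 1
      push_cast
      ring
    rw [e, Complex.exp_add, Complex.exp_int_mul_two_pi_mul_I, mul_one, sub_self]

/-- Writing 2 cos θ = e^{iθ} + e^{-iθ}, one more factor of the symbol shifts the frequency by ±1,
which is the recursion defining `powCoeff`. -/
theorem integral_pow_mul_exp (p : ℕ) (α β : ℂ) (k : ℤ) :
    ∫ θ in (-Real.pi)..Real.pi,
        (α + 2 * β * Real.cos θ) ^ p * Complex.exp (-(Complex.I * k * θ)) =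
      2 * Real.pi * powCoeff p α β k := by
  induction p generalizing k with
  | zero =>
    simp only [pow_zero, one_mul, integral_exp_int_mul, powCoeff]
    split_ifs <;> simp
  | succ p ih =>
    have e : ∀ θ : ℝ, (α + 2 * β * Real.cos θ) ^ (p + 1) * Complex.exp (-(Complex.I * k * θ)) =
        α * ((α + 2 * β * Real.cos θ) ^ p * Complex.exp (-(Complex.I * k * θ))) +
        β * ((α + 2 * β * Real.cos θ) ^ p * Complex.exp (-(Complex.I * (k - 1 : ℤ) * θ)) +
          (α + 2 * β * Real.cos θ) ^ p * Complex.exp (-(Complex.I * (k + 1 : ℤ) * θ))) := by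
      intro θ
      have e1 : Complex.exp (-(Complex.I * (k - 1 : ℤ) * θ)) =
          Complex.exp (-(Complex.I * k * θ)) * Complex.exp (θ * Complex.I) := by
        rw [← Complex.exp_add]; congr 1; push_cast; ring
      have e2 : Complex.exp (-(Complex.I * (k + 1 : ℤ) * θ)) =
          Complex.exp (-(Complex.I * k * θ)) * Complex.exp (-θ * Complex.I) := by
        rw [← Complex.exp_add]; congr 1; push_cast; ring
      rw [e1, e2, Complex.ofReal_cos, Complex.cos, pow_succ]
      ring
    have hc : ∀ l : ℤ, IntervalIntegrable (fun θ : ℝ =>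
        (α + 2 * β * Real.cos θ) ^ p * Complex.exp (-(Complex.I * l * θ))) volume
        (-Real.pi) Real.pi := fun l => Continuous.intervalIntegrable (by fun_prop) _ _
    simp only [e]
    rw [intervalIntegral.integral_add ((hc k).const_mul _) (((hc _).add (hc _)).const_mul _),
      intervalIntegral.integral_const_mul, intervalIntegral.integral_const_mul,
      intervalIntegral.integral_add (hc _) (hc _), ih, ih, ih, powCoeff]
    ring

/-! ### Moments of slowly varying tridiagonal matrices -/

/-- A family of matrices whose entries tend to zero uniformly. -/
def UniformlySmall (f : ∀ N : ℕ, Fin (N + 1) → Fin (N + 1) → ℂ) : Prop :=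
  ∀ ε > 0, ∀ᶠ N in atTop, ∀ i j, ‖f N i j‖ ≤ ε

/-- The tridiagonal matrix with the samples of `a` on the diagonal and, in each row, the sample of
`b` to the left and to the right of the diagonal. -/
noncomputable def tridiagModel (a b : ℝ → ℂ) (N : ℕ) : Matrix (Fin (N + 1)) (Fin (N + 1)) ℂ :=
  Matrix.of fun i j => if j.val = i.val then a (samplePoint N i)
    else if j.val + 1 = i.val ∨ j.val = i.val + 1 then b (samplePoint N i) else 0

theorem isTridiagonal_tridiagModel (a b : ℝ → ℂ) (N : ℕ) : IsTridiagonal (tridiagModel a b N) := by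
  intro i j h
  simp only [tridiagModel, Matrix.of_apply]
  rw [if_neg (by omega), if_neg (by omega)]

theorem norm_tridiagModel_le {a b : ℝ → ℂ} {K : ℝ} (ha : ∀ x ∈ Set.Icc (0 : ℝ) 1, ‖a x‖ ≤ K)
    (hb : ∀ x ∈ Set.Icc (0 : ℝ) 1, ‖b x‖ ≤ K) (N : ℕ) (i j : Fin (N + 1)) :
    ‖tridiagModel a b N i j‖ ≤ K := by
  have h := samplePoint_mem N i
  simp only [tridiagModel, Matrix.of_apply]
  split_ifs
  · exact ha _ h
  · exact hb _ h
  · simpa using (norm_nonneg _).trans (ha _ h)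

theorem samplePoint_last (N : ℕ) : samplePoint N N = 1 :=
  div_self (Nat.cast_add_one_ne_zero N)

/-- A row of the model acts as the three-term stencil on ℤ unless a neighbour is missing. In the
last row the sample point is exactly 1, so b vanishes there; in the first row the defect is
b(x₀)φ(-1), which the right-hand side bounds. -/
theorem norm_tridiagModel_sum_sub_le {a b : ℝ → ℂ} (hb1 : b 1 = 0) {N : ℕ} (i : Fin (N + 1))
    {φ : ℤ → ℂ} {C : ℝ} (hφ : ∀ k, ‖φ k‖ ≤ C) :
    ‖∑ l, tridiagModel a b N i l * φ l - (a (samplePoint N i) * φ i +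
      b (samplePoint N i) * (φ (i - 1) + φ (i + 1)))‖ ≤ ‖b (samplePoint N 0)‖ * C := by
  have hC : 0 ≤ C := (norm_nonneg _).trans (hφ 0)
  have e : ∀ l : Fin (N + 1), tridiagModel a b N i l * φ l =
      (if l = i then a (samplePoint N i) * φ i else 0) +
      (if l.val + 1 = i.val then b (samplePoint N i) * φ (i - 1) else 0) +
      (if l.val = i.val + 1 then b (samplePoint N i) * φ (i + 1) else 0) := by
    intro l
    simp only [tridiagModel, Matrix.of_apply]
    by_cases h1 : l = i
    · subst h1; simp
    · have h1' : l.val ≠ i.val := fun h => h1 (Fin.ext h)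
      rw [if_neg h1', if_neg h1]
      by_cases h2 : l.val + 1 = i.val
      · have : ((l : ℕ) : ℤ) = (i : ℕ) - 1 := by omega
        rw [if_pos (Or.inl h2), if_pos h2, if_neg (by omega), this]
        ring
      · by_cases h3 : l.val = i.val + 1
        · have : ((l : ℕ) : ℤ) = (i : ℕ) + 1 := by omega
          rw [if_pos (Or.inr h3), if_neg h2, if_pos h3, this]
          ring
        · rw [if_neg (by tauto), if_neg h2, if_neg h3]
          ring
  simp only [e, Finset.sum_add_distrib, Finset.sum_ite_eq', Finset.mem_univ, if_true]
  by_cases hN : i.val = N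
  · have hz : b (samplePoint N i) = 0 := by rw [hN, samplePoint_last, hb1]
    simp only [hz, zero_mul, ite_self, Finset.sum_const_zero, add_zero, sub_self, norm_zero]
    positivity
  · have hs : ∀ z : ℂ, ∑ l : Fin (N + 1), (if l.val = i.val + 1 then z else 0) = z := by
      intro z
      rw [Finset.sum_eq_single ⟨i.val + 1, by omega⟩]
      · simp
      · intro l _ hl
        rw [if_neg fun h => hl (Fin.ext h)]
      · simp
    rw [hs]
    by_cases h0 : i.val = 0
    · rw [Finset.sum_eq_zero fun l _ => if_neg (by omega)]
      have : ∀ u v w z : ℂ, u + 0 + v * w - (u + v * (z + w)) = -(v * z) := by intros; ring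
      rw [this, norm_neg, norm_mul, h0]
      gcongr
      exact hφ _
    · rw [Finset.sum_eq_single ⟨i.val - 1, by omega⟩]
      · rw [if_pos (by simp; omega)]
        have : ∀ u v w z : ℂ, u + v * z + v * w - (u + v * (z + w)) = 0 := by intros; ring
        rw [this, norm_zero]
        positivity
      · intro l _ hl
        rw [if_neg fun h => hl (Fin.ext (by simp; omega))]
      · simp

theorem eventually_samplePoint_close {f : ℝ → ℂ} (hf : Continuous f) {ε : ℝ} (hε : 0 < ε) :
    ∀ᶠ N : ℕ in atTop, ∀ (i : Fin (N + 1)) (y : ℝ),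
      |samplePoint N i - y| ≤ 3 / (N : ℝ) → ‖f (samplePoint N i) - f y‖ ≤ ε := by
  -- The point y may leave [0,1], but by less than 3 once 3/N < 3.
  have huc := isCompact_Icc.uniformContinuousOn_of_continuous (s := Set.Icc (-3 : ℝ) 4)
    hf.continuousOn
  rw [Metric.uniformContinuousOn_iff_le] at huc
  obtain ⟨δ, hδ, h⟩ := huc ε hε
  filter_upwards [(tendsto_const_div_atTop_nhds_zero_nat (3 : ℝ)).eventually (gt_mem_nhds hδ),
    (tendsto_const_div_atTop_nhds_zero_nat (3 : ℝ)).eventually (gt_mem_nhds zero_lt_three)]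
    with N hN hN3 i y hiy
  have hx := samplePoint_mem N i
  have hy := abs_le.1 hiy
  rw [← dist_eq_norm]
  exact h _ ⟨by linarith [hx.1], by linarith [hx.2]⟩ y
    ⟨by linarith [hx.1, hy.2], by linarith [hx.2, hy.1]⟩ (hiy.trans hN.le)

theorem abs_samplePoint_sub_le {N : ℕ} {i j : Fin (N + 1)} (h : j ∈ neighbours i) :
    |samplePoint N i - samplePoint N j| ≤ 3 / (N : ℝ) := by
  rcases Nat.eq_zero_or_pos N with rfl | hN
  · have : i = j := Fin.ext (by omega)
    simp [this]
  have hN' : (0 : ℝ) < N := by exact_mod_cast hN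
  obtain ⟨h1, h2⟩ := mem_neighbours.1 h
  have h1' : (i : ℝ) ≤ j + 1 := by exact_mod_cast h1
  have h2' : (j : ℝ) ≤ i + 1 := by exact_mod_cast h2
  have e : samplePoint N i - samplePoint N j = ((i : ℝ) - j) / ((N : ℝ) + 1) := by
    unfold samplePoint; ring
  rw [e, abs_div, abs_of_pos (by positivity : (0 : ℝ) < (N : ℝ) + 1)]
  refine div_le_div₀ (by norm_num) ?_ hN' (by linarith)
  rw [abs_le]; constructor <;> linarith

/-- Induction on p through A^{p+1} = A·Aᵖ. Four errors occur: A is replaced by the model, Aᵖ by its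
approximation from the induction hypothesis, the symbol at x_l by the symbol at xᵢ, and the
truncated row by the full stencil. -/
theorem uniformlySmall_pow_sub_powCoeff {a b : ℝ → ℂ} (ha : Continuous a) (hb : Continuous b)
    (hb0 : b 0 = 0) (hb1 : b 1 = 0) {A : ∀ N : ℕ, Matrix (Fin (N + 1)) (Fin (N + 1)) ℂ}
    (hA : ∀ N, IsTridiagonal (A N)) (hAs : UniformlySmall fun N => A N - tridiagModel a b N)
    (p : ℕ) : UniformlySmall fun N i j => (A N ^ p) i j -
      powCoeff p (a (samplePoint N i)) (b (samplePoint N i)) ((i : ℤ) - (j : ℤ)) := by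
  obtain ⟨K₁, hK₁⟩ := isCompact_Icc.exists_bound_of_continuousOn (s := Set.Icc (0 : ℝ) 1)
    ha.continuousOn
  obtain ⟨K₂, hK₂⟩ := isCompact_Icc.exists_bound_of_continuousOn (s := Set.Icc (0 : ℝ) 1)
    hb.continuousOn
  set K := max K₁ K₂
  have haK : ∀ x ∈ Set.Icc (0 : ℝ) 1, ‖a x‖ ≤ K := fun x hx => (hK₁ x hx).trans (le_max_left _ _)
  have hbK : ∀ x ∈ Set.Icc (0 : ℝ) 1, ‖b x‖ ≤ K := fun x hx => (hK₂ x hx).trans (le_max_right _ _)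
  have hK : 0 ≤ K := (norm_nonneg _).trans (haK 0 (by simp))
  induction p with
  | zero =>
    intro ε hε
    refine Eventually.of_forall fun N i j => ?_
    have : (((i : ℕ) : ℤ) - (j : ℕ) = 0) ↔ i = j := by
      rw [sub_eq_zero, Nat.cast_inj, Fin.ext_iff]
    simp only [pow_zero, powCoeff, Matrix.one_apply, this, sub_self, norm_zero]
    exact hε.le
  | succ p ih =>
    intro ε hε
    obtain ⟨L, hL, hLip⟩ := exists_norm_powCoeff_sub_le hK p
    set C := (3 * K) ^ p
    have hC : 0 ≤ C := by positivity
    -- S adds up the coefficients of η in the four error bounds; the final 1 keeps it positive.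
    set S := 3 * (C + 1) + 3 * K + 3 * (K * (2 * L)) + C + 1
    have hS : 0 < S := by positivity
    -- The cap at 1 gives the bound C + 1 on the entries of Aᵖ.
    have hη : 0 < min (ε / S) 1 := by positivity
    set η := min (ε / S) 1
    have hb0' := eventually_samplePoint_close hb hη
    filter_upwards [hAs η hη, ih η hη, eventually_samplePoint_close ha hη, hb0',
      eventually_gt_atTop 0] with N h1 h2 h3 h4 hN i j
    have hη1 : η ≤ 1 := min_le_right _ _
    have hηε : S * η ≤ ε := by
      calc S * η ≤ S * (ε / S) := by gcongr; exact min_le_left _ _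
        _ = ε := by field_simp
    have hm := samplePoint_mem N i
    have hpow : ∀ l, ‖(A N ^ p) l j‖ ≤ C + 1 := by
      intro l
      have := norm_le_norm_add_norm_sub' ((A N ^ p) l j)
        (powCoeff p (a (samplePoint N l)) (b (samplePoint N l)) ((l : ℤ) - (j : ℤ)))
      have hn := norm_powCoeff_le (haK _ (samplePoint_mem N l)) (hbK _ (samplePoint_mem N l)) p
        ((l : ℤ) - (j : ℤ))
      linarith [h2 l j]
    -- The first sample point 1/(N+1) is within 3/N of 0, where b vanishes; this controls the
    -- boundary defect.
    have hb0N : ‖b (samplePoint N 0)‖ ≤ η := by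
      have := h4 0 0 (by
        have hN' : (0 : ℝ) < N := by exact_mod_cast hN
        simp only [samplePoint, Fin.val_zero, Nat.cast_zero, zero_add, sub_zero]
        rw [abs_of_pos (by positivity)]
        exact div_le_div₀ (by norm_num) (by norm_num) hN' (by linarith))
      simpa [hb0] using this
    set M := tridiagModel a b N
    have hM := isTridiagonal_tridiagModel a b N
    have t1 : ‖∑ l, (A N - M) i l * (A N ^ p) l j‖ ≤ 3 * (η * (C + 1)) :=
      ((hA N).sub hM).norm_sum_le (fun l => h1 i l) (fun l _ => hpow l) (by positivity)
    have t2 : ‖∑ l, M i l * ((A N ^ p) l j -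
        powCoeff p (a (samplePoint N l)) (b (samplePoint N l)) ((l : ℤ) - (j : ℤ)))‖ ≤
        3 * (K * η) :=
      hM.norm_sum_le (fun l => norm_tridiagModel_le haK hbK N i l) (fun l _ => h2 l j) hη.le
    have t3 : ‖∑ l, M i l * (powCoeff p (a (samplePoint N l)) (b (samplePoint N l)) ((l : ℤ) - j) -
        powCoeff p (a (samplePoint N i)) (b (samplePoint N i)) ((l : ℤ) - (j : ℤ)))‖ ≤
        3 * (K * (L * (η + η))) := by
      refine hM.norm_sum_le (fun l => norm_tridiagModel_le haK hbK N i l) (fun l hl => ?_)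
        (by positivity)
      have hm' := samplePoint_mem N l
      refine (hLip _ _ _ _ _ (haK _ hm') (hbK _ hm') (haK _ hm) (hbK _ hm)).trans ?_
      have hd := abs_samplePoint_sub_le (mem_neighbours_comm.1 hl)
      gcongr
      · exact h3 l _ hd
      · exact h4 l _ hd
    have t4 := norm_tridiagModel_sum_sub_le (a := a) hb1 i
      (φ := fun k => powCoeff p (a (samplePoint N i)) (b (samplePoint N i)) (k - (j : ℤ)))
      (C := C) (fun k => norm_powCoeff_le (haK _ hm) (hbK _ hm) p _)
    have t4' : ‖b (samplePoint N 0)‖ * C ≤ η * C := by gcongr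
    have e : (A N ^ (p + 1)) i j -
        powCoeff (p + 1) (a (samplePoint N i)) (b (samplePoint N i)) ((i : ℤ) - (j : ℤ)) =
        ∑ l, (A N - M) i l * (A N ^ p) l j +
        ∑ l, M i l * ((A N ^ p) l j -
          powCoeff p (a (samplePoint N l)) (b (samplePoint N l)) ((l : ℤ) - (j : ℤ))) +
        ∑ l, M i l * (powCoeff p (a (samplePoint N l)) (b (samplePoint N l)) ((l : ℤ) - j) -
          powCoeff p (a (samplePoint N i)) (b (samplePoint N i)) ((l : ℤ) - (j : ℤ))) +
        (∑ l : Fin (N + 1), M i l *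
          powCoeff p (a (samplePoint N i)) (b (samplePoint N i)) ((l : ℤ) - (j : ℤ)) -
          powCoeff (p + 1) (a (samplePoint N i)) (b (samplePoint N i)) ((i : ℤ) - (j : ℤ))) := by
      rw [pow_succ', Matrix.mul_apply, ← add_sub_assoc, ← Finset.sum_add_distrib,
        ← Finset.sum_add_distrib, ← Finset.sum_add_distrib]
      congr 1
      refine Finset.sum_congr rfl fun l _ => ?_
      rw [Matrix.sub_apply]
      ring
    have t4'' : ‖∑ l : Fin (N + 1), M i l *
          powCoeff p (a (samplePoint N i)) (b (samplePoint N i)) ((l : ℤ) - (j : ℤ)) -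
          powCoeff (p + 1) (a (samplePoint N i)) (b (samplePoint N i)) ((i : ℤ) - (j : ℤ))‖ ≤
          η * C := by
      refine le_trans (le_of_eq ?_) (t4.trans t4')
      rw [powCoeff, sub_right_comm, add_sub_right_comm]
    rw [e]
    refine (norm_add_le _ _).trans ?_
    have t5 := norm_add₃_le (a := ∑ l, (A N - M) i l * (A N ^ p) l j)
      (b := ∑ l, M i l * ((A N ^ p) l j -
          powCoeff p (a (samplePoint N l)) (b (samplePoint N l)) ((l : ℤ) - (j : ℤ))))
      (c := ∑ l, M i l * (powCoeff p (a (samplePoint N l)) (b (samplePoint N l)) ((l : ℤ) - j) -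
          powCoeff p (a (samplePoint N i)) (b (samplePoint N i)) ((l : ℤ) - (j : ℤ))))
    have : S * η = 3 * (η * (C + 1)) + 3 * (K * η) + 3 * (K * (L * (η + η))) + η * C + η := by
      simp only [S]; ring
    linarith

/-- On the diagonal i - j = 0, so the normalized trace is a Riemann sum of zeroth Fourier
coefficients up to a uniformly small error. -/
theorem tendsto_trace_pow {a b : ℝ → ℂ} (ha : Continuous a) (hb : Continuous b)
    (hb0 : b 0 = 0) (hb1 : b 1 = 0) {A : ∀ N : ℕ, Matrix (Fin (N + 1)) (Fin (N + 1)) ℂ}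
    (hA : ∀ N, IsTridiagonal (A N)) (hAs : UniformlySmall fun N => A N - tridiagModel a b N)
    (p : ℕ) : Tendsto (fun N => (A N ^ p).trace / ((N : ℂ) + 1)) atTop
      (𝓝 (∫ x in (0 : ℝ)..1, powCoeff p (a x) (b x) 0)) := by
  have h1 := tendsto_mean_samplePoint (continuous_powCoeff ha hb p 0)
  have h2 : Tendsto (fun N : ℕ => (∑ i : Fin (N + 1), ((A N ^ p) i i -
      powCoeff p (a (samplePoint N i)) (b (samplePoint N i)) 0)) / ((N : ℂ) + 1)) atTop (𝓝 0) := by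
    rw [Metric.tendsto_nhds]
    intro ε hε
    filter_upwards [uniformlySmall_pow_sub_powCoeff ha hb hb0 hb1 hA hAs p (ε / 2) (by positivity)]
      with N hN
    rw [dist_zero_right]
    refine (norm_sum_div_le (r := ε / 2) fun i => ?_).trans_lt (by linarith)
    simpa using hN i i
  have h := h2.add h1
  rw [zero_add] at h
  refine h.congr fun N => ?_
  rw [← add_div, Finset.sum_sub_distrib, sub_add_cancel]
  rfl

/-! ### Distribution of Hermitian tridiagonal sequences -/

theorem volume_real_gltDomain : volume.real gltDomain = 2 * Real.pi := by
  have hpi := Real.pi_pos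
  rw [gltDomain, Measure.volume_eq_prod, measureReal_prod_prod, Real.volume_real_Icc_of_le zero_le_one,
    Real.volume_real_Icc_of_le (by linarith)]
  ring

theorem measurableSet_gltDomain : MeasurableSet gltDomain := measurableSet_Icc.prod measurableSet_Icc

theorem isCompact_gltDomain : IsCompact gltDomain := isCompact_Icc.prod isCompact_Icc

instance : IsFiniteMeasure (volume.restrict gltDomain) :=
  ⟨by rw [Measure.restrict_apply_univ]; exact isCompact_gltDomain.measure_lt_top⟩

/-- Together with finiteness this makes the normalized restriction, against which `⨍` integrates, a
probability measure. -/
instance : NeZero (volume.restrict gltDomain) := by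
  refine ⟨fun h => ?_⟩
  rw [Measure.restrict_eq_zero] at h
  have h2 := volume_real_gltDomain
  rw [measureReal_def, h] at h2
  simp [Real.pi_ne_zero] at h2

theorem setAverage_gltDomain {f : ℝ × ℝ → ℂ} (hf : Continuous f) :
    ⨍ p in gltDomain, f p =
      (1 / (2 * Real.pi)) * ∫ x in (0 : ℝ)..1, ∫ θ in (-Real.pi)..Real.pi, f (x, θ) := by
  have hpi := Real.pi_pos
  rw [setAverage_eq, volume_real_gltDomain, gltDomain, Measure.volume_eq_prod, setIntegral_prod,
    integral_Icc_eq_integral_Ioc, ← intervalIntegral.integral_of_le zero_le_one, Complex.real_smul]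
  · push_cast
    rw [one_div]
    congr 1
    refine intervalIntegral.integral_congr fun x _ => ?_
    rw [integral_Icc_eq_integral_Ioc, ← intervalIntegral.integral_of_le (by linarith)]
  · exact hf.continuousOn.integrableOn_compact isCompact_gltDomain

theorem setAverage_pow {a b : ℝ → ℝ} (ha : Continuous a) (hb : Continuous b) (p : ℕ) :
    ⨍ z in gltDomain, ((a z.1 + 2 * b z.1 * Real.cos z.2 : ℝ) : ℂ) ^ p =
      ∫ x in (0 : ℝ)..1, powCoeff p (a x) (b x) 0 := by
  rw [setAverage_gltDomain (by fun_prop), ← intervalIntegral.integral_const_mul]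
  refine intervalIntegral.integral_congr fun x _ => ?_
  have h := integral_pow_mul_exp p (a x) (b x) 0
  simp only [Int.cast_zero, mul_zero, zero_mul, neg_zero, Complex.exp_zero, mul_one] at h
  have hpi : (Real.pi : ℂ) ≠ 0 := by exact_mod_cast Real.pi_ne_zero
  push_cast at h ⊢
  rw [h]
  field_simp

theorem exists_bound_unit {a b : ℝ → ℝ} (ha : Continuous a) (hb : Continuous b) :
    ∃ K : ℝ, 0 ≤ K ∧ ∀ x ∈ Set.Icc (0 : ℝ) 1, |a x| ≤ K ∧ |b x| ≤ K := by
  obtain ⟨K₁, hK₁⟩ := isCompact_Icc.exists_bound_of_continuousOn (s := Set.Icc (0 : ℝ) 1)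
    ha.continuousOn
  obtain ⟨K₂, hK₂⟩ := isCompact_Icc.exists_bound_of_continuousOn (s := Set.Icc (0 : ℝ) 1)
    hb.continuousOn
  exact ⟨max K₁ K₂, (abs_nonneg _).trans ((hK₁ 0 (by simp)).trans (le_max_left _ _)),
    fun x hx => ⟨(hK₁ x hx).trans (le_max_left _ _), (hK₂ x hx).trans (le_max_right _ _)⟩⟩

/-- The entries are eventually within 1 of the model. The same bound 3(K+1) holds for the symbol in
`abs_symbol_le`, so a single interval contains the spectra and the range of the symbol. -/
theorem eventually_spectralNorm_le {a b : ℝ → ℝ} {K : ℝ} (hK : 0 ≤ K)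
    (hab : ∀ x ∈ Set.Icc (0 : ℝ) 1, |a x| ≤ K ∧ |b x| ≤ K)
    {A : ∀ N : ℕ, Matrix (Fin (N + 1)) (Fin (N + 1)) ℂ} (hA : ∀ N, IsTridiagonal (A N))
    (hAs : UniformlySmall fun N => A N - tridiagModel (fun x => a x) (fun x => b x) N) :
    ∀ᶠ N in atTop, spectralNorm (A N) ≤ 3 * (K + 1) := by
  filter_upwards [hAs 1 one_pos] with N hN
  refine (hA N).spectralNorm_le (by linarith) fun i j => ?_
  have h1 := norm_le_norm_add_norm_sub' (A N i j) (tridiagModel (fun x => a x) (fun x => b x) N i j)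
  have h2 := norm_tridiagModel_le (a := fun x => (a x : ℂ)) (b := fun x => (b x : ℂ)) (K := K)
    (fun x hx => by simpa using (hab x hx).1) (fun x hx => by simpa using (hab x hx).2) N i j
  have h3 : ‖A N i j - tridiagModel (fun x => a x) (fun x => b x) N i j‖ ≤ 1 := hN i j
  linarith

theorem abs_symbol_le {a b : ℝ → ℝ} {K : ℝ}
    (hab : ∀ x ∈ Set.Icc (0 : ℝ) 1, |a x| ≤ K ∧ |b x| ≤ K) {z : ℝ × ℝ} (hz : z ∈ gltDomain) :
    |a z.1 + 2 * b z.1 * Real.cos z.2| ≤ 3 * (K + 1) := by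
  obtain ⟨h1, h2⟩ := hab z.1 hz.1
  have h3 : |b z.1 * Real.cos z.2| ≤ K := by
    rw [abs_mul]
    exact (mul_le_of_le_one_right (abs_nonneg _) (Real.abs_cos_le_one _)).trans h2
  rw [abs_le] at h1 h3 ⊢
  constructor <;> nlinarith [h1.1, h1.2, h3.1, h3.2]

theorem ae_average_of_forall_mem {P : ℝ × ℝ → Prop} (h : ∀ z ∈ gltDomain, P z) :
    ∀ᵐ z ∂((volume.restrict gltDomain Set.univ)⁻¹ • volume.restrict gltDomain), P z :=
  Measure.ae_smul_measure ((ae_restrict_iff' measurableSet_gltDomain).2 (Eventually.of_forall h)) _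

/-- The exponents p and q are kept separate to serve both distributions: q = p for the eigenvalues
of A, while the q-th moment of A*A is the trace of A^{2q}. -/
theorem tendsto_moments {a b : ℝ → ℝ} (ha : Continuous a) (hb : Continuous b)
    (hb0 : b 0 = 0) (hb1 : b 1 = 0) {A : ∀ N : ℕ, Matrix (Fin (N + 1)) (Fin (N + 1)) ℂ}
    (hA : ∀ N, IsTridiagonal (A N))
    (hAs : UniformlySmall fun N => A N - tridiagModel (fun x => a x) (fun x => b x) N) (p : ℕ)
    {v : ∀ N : ℕ, Fin (N + 1) → ℝ} {q : ℕ}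
    (hv : ∀ N, (A N ^ p).trace = ∑ i, (v N i : ℂ) ^ q) :
    Tendsto (fun N => (∑ i, v N i ^ q) / ((N : ℝ) + 1)) atTop
      (𝓝 (⨍ z in gltDomain, (a z.1 + 2 * b z.1 * Real.cos z.2) ^ p)) := by
  have h := tendsto_trace_pow (a := fun x => a x) (b := fun x => b x) (by fun_prop) (by fun_prop)
    (by simp [hb0]) (by simp [hb1]) hA hAs p
  rw [← setAverage_pow ha hb p] at h
  have h2 := (Complex.continuous_re.tendsto _).comp h
  have e : ⨍ z in gltDomain, ((a z.1 + 2 * b z.1 * Real.cos z.2 : ℝ) : ℂ) ^ p =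
      ((⨍ z in gltDomain, (a z.1 + 2 * b z.1 * Real.cos z.2) ^ p : ℝ) : ℂ) := by
    simp only [← Complex.ofReal_pow]
    exact integral_ofReal
  rw [e, Complex.ofReal_re] at h2
  refine h2.congr fun N => ?_
  have e2 : (A N ^ p).trace / ((N : ℂ) + 1) =
      (((∑ i, v N i ^ q) / ((N : ℝ) + 1) : ℝ) : ℂ) := by
    rw [hv]; push_cast; rfl
  rw [Function.comp_apply, e2, Complex.ofReal_re]

theorem hasEigenvalueDistribution_of_isTridiagonal {a b : ℝ → ℝ} (ha : Continuous a)
    (hb : Continuous b) (hb0 : b 0 = 0) (hb1 : b 1 = 0)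
    {A : ∀ N : ℕ, Matrix (Fin (N + 1)) (Fin (N + 1)) ℂ}
    (hA : ∀ N, IsTridiagonal (A N)) (hH : ∀ N, (A N).IsHermitian)
    (hAs : UniformlySmall fun N => A N - tridiagModel (fun x => a x) (fun x => b x) N) :
    HasEigenvalueDistribution (fun N => N + 1) A
      (fun z => ((a z.1 + 2 * b z.1 * Real.cos z.2 : ℝ) : ℂ)) gltDomain := by
  refine ⟨(by fun_prop : Continuous _).aemeasurable, fun F hF _ => ?_⟩
  obtain ⟨K, hK, hab⟩ := exists_bound_unit ha hb
  have key := tendsto_mean_complex_of_moments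
    (μ := (volume.restrict gltDomain Set.univ)⁻¹ • volume.restrict gltDomain)
    (g := fun z => a z.1 + 2 * b z.1 * Real.cos z.2) (M := 3 * (K + 1))
    (v := fun N => (hH N).eigenvalues) (F := fun t => F (t : ℂ))
    (by fun_prop : Continuous _).aestronglyMeasurable
    (ae_average_of_forall_mem fun z hz => abs_symbol_le hab hz)
    ((eventually_spectralNorm_le hK hab hA hAs).mono fun N hN i =>
      (abs_eigenvalues_le_spectralNorm (hH N) i).trans hN)
    (fun p => tendsto_moments ha hb hb0 hb1 hA hAs p
      fun N => trace_pow_eq_sum_eigenvalues (hH N) p)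
    (by fun_prop)
  refine key.congr fun N => ?_
  rw [sum_map_roots_charpoly (hH N)]
  push_cast
  rfl

/-- The moment method is applied to A*A = A², with limit function the square of the symbol and test
function t ↦ F(√t); then √(g²) = |g|. -/
theorem hasSingularValueDistribution_of_isTridiagonal {a b : ℝ → ℝ} (ha : Continuous a)
    (hb : Continuous b) (hb0 : b 0 = 0) (hb1 : b 1 = 0)
    {A : ∀ N : ℕ, Matrix (Fin (N + 1)) (Fin (N + 1)) ℂ}
    (hA : ∀ N, IsTridiagonal (A N)) (hH : ∀ N, (A N).IsHermitian)
    (hAs : UniformlySmall fun N => A N - tridiagModel (fun x => a x) (fun x => b x) N) :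
    HasSingularValueDistribution (fun N => N + 1) A
      (fun z => ((a z.1 + 2 * b z.1 * Real.cos z.2 : ℝ) : ℂ)) gltDomain := by
  refine ⟨(by fun_prop : Continuous _).aemeasurable, fun F hF _ => ?_⟩
  obtain ⟨K, hK, hab⟩ := exists_bound_unit ha hb
  have key := tendsto_mean_complex_of_moments
    (μ := (volume.restrict gltDomain Set.univ)⁻¹ • volume.restrict gltDomain)
    (g := fun z => (a z.1 + 2 * b z.1 * Real.cos z.2) ^ 2) (M := (3 * (K + 1)) ^ 2)
    (v := fun N => (Matrix.isHermitian_conjTranspose_mul_self (A N)).eigenvalues)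
    (F := fun t => F √t)
    (by fun_prop : Continuous _).aestronglyMeasurable
    (ae_average_of_forall_mem fun z hz => by
      rw [abs_pow]
      exact pow_le_pow_left₀ (abs_nonneg _) (abs_symbol_le hab hz) 2)
    ((eventually_spectralNorm_le hK hab hA hAs).mono fun N hN i => by
      refine (abs_eigenvalues_le_spectralNorm _ i).trans ?_
      rw [(hH N).eq, spectralNorm, map_mul, sq]
      exact (norm_mul_le _ _).trans (mul_le_mul hN hN (norm_nonneg _) (by positivity)))
    (fun p => by
      simp only [← pow_mul]
      refine tendsto_moments ha hb hb0 hb1 hA hAs (2 * p) fun N => ?_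
      rw [← trace_pow_eq_sum_eigenvalues, (hH N).eq, pow_mul, sq])
    (by fun_prop)
  simp only [Real.sqrt_sq_eq_abs] at key
  have e : ∀ z : ℝ × ℝ, ‖((a z.1 + 2 * b z.1 * Real.cos z.2 : ℝ) : ℂ)‖ =
      |a z.1 + 2 * b z.1 * Real.cos z.2| := fun z => Complex.norm_real _
  simp only [e]
  refine key.congr fun N => ?_
  rw [sum_singularValues_eq]
  push_cast
  rfl

/-! ### Locally Toeplitz decomposition -/

theorem fourierCoefficient_exp {f : ℝ → ℂ} {m : ℤ} (hf : ∀ θ, f θ = Complex.exp (Complex.I * m * θ))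
    (k : ℤ) : fourierCoefficient f k = if k = m then 1 else 0 := by
  have h := integral_exp_int_mul (k - m)
  have hpi : (Real.pi : ℂ) ≠ 0 := by exact_mod_cast Real.pi_ne_zero
  have e : ∀ θ : ℝ, f θ * Complex.exp (-(Complex.I * k * θ)) =
      Complex.exp (-(Complex.I * (k - m : ℤ) * θ)) := by
    intro θ
    rw [hf, ← Complex.exp_add]
    congr 1
    push_cast
    ring
  simp only [fourierCoefficient, e, h, sub_eq_zero]
  split_ifs
  · field_simp
  · simp

theorem toeplitz_exp_apply {f : ℝ → ℂ} {m : ℤ} (hf : ∀ θ, f θ = Complex.exp (Complex.I * m * θ))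
    {n : ℕ} (i j : Fin n) : toeplitz n f i j = if (i : ℤ) = j + m then 1 else 0 := by
  simp only [toeplitz, Matrix.of_apply, fourierCoefficient_exp hf, sub_eq_iff_eq_add']

theorem riemannIntegrableUnit_of_continuous {a : ℝ → ℂ} (ha : Continuous a) :
    RiemannIntegrableUnit a :=
  ⟨isCompact_Icc.exists_bound_of_continuousOn ha.continuousOn,
    Eventually.of_forall fun _ => ha.continuousWithinAt⟩

/-- The exponents of the three Fourier modes of a tridiagonal symbol. -/
def modeIndex : Fin 3 → ℤ := ![0, 1, -1]

/-- Left multiplication by a diagonal matrix scales rows, which is why the model samples b at the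
row index on both sides of the diagonal. -/
theorem sum_locallyToeplitz_eq (a b : ℝ → ℂ) (N : ℕ) :
    ∑ i : Fin 3, locallyToeplitz (N + 1) (![a, b, b] i)
      (fun θ => Complex.exp (Complex.I * modeIndex i * θ)) = tridiagModel a b N := by
  ext i j
  have e : (((i : ℕ) : ℝ) + 1) / ((N + 1 : ℕ) : ℝ) = samplePoint N i := by
    simp [samplePoint]
  simp only [Fin.sum_univ_three, Matrix.add_apply, locallyToeplitz, samplingDiag,
    Matrix.diagonal_mul, toeplitz_exp_apply (fun _ => rfl), e, tridiagModel, Matrix.of_apply,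
    modeIndex, Matrix.cons_val_zero, Matrix.cons_val_one, Matrix.cons_val]
  have hc : ((i : ℕ) : ℤ) = j + 0 ↔ j.val = i.val := by omega
  have hl : ((i : ℕ) : ℤ) = j + 1 ↔ j.val + 1 = i.val := by omega
  have hr : ((i : ℕ) : ℤ) = j + -1 ↔ j.val = i.val + 1 := by omega
  simp only [hc, hl, hr]
  by_cases h1 : j.val = i.val
  · rw [if_pos h1, if_pos h1, if_neg (by omega), if_neg (by omega)]; ring
  · by_cases h2 : j.val + 1 = i.val
    · rw [if_neg h1, if_neg h1, if_pos h2, if_pos (Or.inl h2), if_neg (by omega)]; ring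
    · by_cases h3 : j.val = i.val + 1
      · rw [if_neg h1, if_neg h1, if_neg h2, if_pos h3, if_pos (Or.inr h3)]; ring
      · rw [if_neg h1, if_neg h1, if_neg h2, if_neg h3, if_neg (by tauto)]; ring

/-- The approximating sequence does not depend on m; only the threshold does, chosen so that the
norm error is at most 3/(m+1). -/
theorem isACS_of_isTridiagonal {a b : ℝ → ℂ}
    {A : ∀ N : ℕ, Matrix (Fin (N + 1)) (Fin (N + 1)) ℂ} (hA : ∀ N, IsTridiagonal (A N))
    (hAs : UniformlySmall fun N => A N - tridiagModel a b N) :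
    IsACS (fun N => N + 1) (fun _ N => tridiagModel a b N) A := by
  have h : ∀ m : ℕ, ∃ n₀ : ℕ, ∀ n, n₀ ≤ n →
      spectralNorm (A n - tridiagModel a b n) ≤ 3 * (1 / ((m : ℝ) + 1)) := by
    intro m
    obtain ⟨n₀, hn₀⟩ := eventually_atTop.1 (hAs (1 / ((m : ℝ) + 1)) (by positivity))
    exact ⟨n₀, fun n hn => ((hA n).sub (isTridiagonal_tridiagModel a b n)).spectralNorm_le
      (by positivity) (hn₀ n hn)⟩
  choose n₀ hn₀ using h
  refine ⟨n₀, fun _ => 0, fun m => 3 * (1 / ((m : ℝ) + 1)), tendsto_const_nhds, ?_,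
    fun m n hn => ⟨0, A n - tridiagModel a b n, by simp, by simp, hn₀ m n hn⟩⟩
  simpa using (tendsto_one_div_add_atTop_nhds_zero_nat (𝕜 := ℝ)).const_mul 3

theorem isGLTSigmaLambda_of_isTridiagonal {a b : ℝ → ℝ} (ha : Continuous a)
    (hb : Continuous b) (hb0 : b 0 = 0) (hb1 : b 1 = 0)
    {A : ∀ N : ℕ, Matrix (Fin (N + 1)) (Fin (N + 1)) ℂ}
    (hA : ∀ N, IsTridiagonal (A N)) (hH : ∀ N, (A N).IsHermitian)
    (hAs : UniformlySmall fun N => A N - tridiagModel (fun x => a x) (fun x => b x) N) :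
    IsGLTSigmaLambda (fun N => N + 1) A
      (fun z => ((a z.1 + 2 * b z.1 * Real.cos z.2 : ℝ) : ℂ)) := by
  refine ⟨⟨tendsto_add_atTop_nat 1, (by fun_prop : Continuous _).aemeasurable, fun _ => 3,
      fun _ => ![fun x => a x, fun x => b x, fun x => b x],
      fun _ i θ => Complex.exp (Complex.I * modeIndex i * θ), ?_, ?_, ?_, ?_⟩,
    hasSingularValueDistribution_of_isTridiagonal ha hb hb0 hb1 hA hH hAs,
    hasEigenvalueDistribution_of_isTridiagonal ha hb hb0 hb1 hA hH hAs⟩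
  · intro _ i
    have hac : Continuous fun x => (a x : ℂ) := by fun_prop
    have hbc : Continuous fun x => (b x : ℂ) := by fun_prop
    fin_cases i
    exacts [riemannIntegrableUnit_of_continuous hac, riemannIntegrableUnit_of_continuous hbc,
      riemannIntegrableUnit_of_continuous hbc]
  · intro _ i
    exact (by fun_prop : Continuous _).continuousOn.integrableOn_compact isCompact_Icc
  · have e : ∀ z : ℝ × ℝ, ∑ i : Fin 3,
        (![fun x => (a x : ℂ), fun x => (b x : ℂ), fun x => (b x : ℂ)] : Fin 3 → ℝ → ℂ) i z.1 *
          Complex.exp (Complex.I * modeIndex i * z.2) =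
        ((a z.1 + 2 * b z.1 * Real.cos z.2 : ℝ) : ℂ) := by
      intro z
      simp only [Fin.sum_univ_three, modeIndex, Matrix.cons_val_zero, Matrix.cons_val_one,
        Matrix.cons_val, Int.cast_zero, mul_zero, zero_mul, Complex.exp_zero, Int.cast_one,
        Int.cast_neg, mul_one]
      push_cast
      rw [Complex.cos, show Complex.I * (-1 : ℂ) * z.2 = -(z.2 : ℂ) * Complex.I by ring,
        mul_comm Complex.I]
      ring
    -- The symbols equal κ exactly for every m, so convergence in measure is that of a constant
    -- sequence.
    refine TendstoInMeasure.congr_left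
      (f := fun _ z => ((a z.1 + 2 * b z.1 * Real.cos z.2 : ℝ) : ℂ))
      (fun _ => ae_of_all _ fun z => (e z).symm) fun ε hε => ?_
    simp [hε.ne']
  · simp only [sum_locallyToeplitz_eq]
    exact isACS_of_isTridiagonal hA hAs

/-! ### The Curie–Weiss tridiagonal matrices -/

/-- The part of the Curie–Weiss symbol that does not depend on `θ`. -/
noncomputable def cwDiagonal (Γ x : ℝ) : ℝ := -(Γ / 2) * (2 * x - 1) ^ 2

/-- The coefficient of `2 cos θ` in the Curie–Weiss symbol. -/
noncomputable def cwOffDiagonal (B x : ℝ) : ℝ := -B * √((1 - x) * x)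

theorem continuous_cwDiagonal (Γ : ℝ) : Continuous (cwDiagonal Γ) := by
  unfold cwDiagonal; fun_prop

theorem continuous_cwOffDiagonal (B : ℝ) : Continuous (cwOffDiagonal B) := by
  unfold cwOffDiagonal; fun_prop

theorem cwSymbol_eq (Γ B : ℝ) : cwSymbol Γ B =
    fun z => ((cwDiagonal Γ z.1 + 2 * cwOffDiagonal B z.1 * Real.cos z.2 : ℝ) : ℂ) := by
  funext z
  simp only [cwSymbol, cwDiagonal, cwOffDiagonal]
  congr 1
  ring

theorem cwOffDiagonal_of_mem (B : ℝ) {x : ℝ} (hx : x ∈ Set.Icc (0 : ℝ) 1) :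
    cwOffDiagonal B x = -B * (√(1 - x) * √x) := by
  rw [cwOffDiagonal, Real.sqrt_mul (by linarith [hx.2])]

theorem isTridiagonal_cwTridiag (Γ B : ℝ) (s N : ℕ) : IsTridiagonal (cwTridiag Γ B s N) := by
  intro i j h
  simp only [cwTridiag, Matrix.of_apply]
  rw [if_neg (by omega), if_neg (by omega), if_neg (by omega), Complex.ofReal_zero]

/-- The left entry in row k+1 and the right entry in row k are the same real number. -/
theorem isHermitian_cwTridiag (Γ B : ℝ) (s N : ℕ) : (cwTridiag Γ B s N).IsHermitian := by
  ext i j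
  simp only [Matrix.conjTranspose_apply, cwTridiag, Matrix.of_apply, Complex.star_def,
    Complex.conj_ofReal]
  congr 1
  by_cases h1 : j.val = i.val
  · rw [if_pos h1, if_pos h1.symm, h1]
  · by_cases h2 : j.val + 1 = i.val
    · have e : (i : ℝ) = j + 1 := by exact_mod_cast h2.symm
      rw [if_neg h1, if_neg (Ne.symm h1), if_pos h2, if_neg (by omega), if_pos (by omega), e]
      ring_nf
    · by_cases h3 : j.val = i.val + 1
      · have e : (j : ℝ) = i + 1 := by exact_mod_cast h3
        rw [if_neg h1, if_neg (Ne.symm h1), if_neg h2, if_pos (by omega), if_pos h3, e]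
        ring_nf
      · rw [if_neg h1, if_neg (Ne.symm h1), if_neg h2, if_neg h3, if_neg (by omega),
          if_neg (by omega)]

/-- Every argument in row i of `cwTridiag` is (i+t)/N with t between s-1 and s+1, so [-1, 2] covers
both labellings. -/
theorem abs_samplePoint_sub_div_le {N : ℕ} (hN : 0 < N) (i : Fin (N + 1)) {t : ℝ}
    (h1 : -1 ≤ t) (h2 : t ≤ 2) : |samplePoint N i - ((i : ℝ) + t) / N| ≤ 3 / (N : ℝ) := by
  have hN' : (0 : ℝ) < N := by exact_mod_cast hN
  have hm := samplePoint_mem N i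
  have e : samplePoint N i - ((i : ℝ) + t) / N = (1 - t - samplePoint N i) / N := by
    unfold samplePoint
    field_simp
    ring
  rw [e, abs_div, abs_of_pos hN']
  gcongr
  rw [abs_le]
  constructor <;> linarith [hm.1, hm.2]

theorem abs_mul_sub_mul_le {u v x y δ : ℝ} (hδ : δ ≤ 1) (hx : |x| ≤ 1) (hy : |y| ≤ 1)
    (hu : |x - u| ≤ δ) (hv : |y - v| ≤ δ) : |u * v - x * y| ≤ 3 * δ := by
  have hδ0 : 0 ≤ δ := (abs_nonneg _).trans hu
  have e : u * v - x * y = (x - u) * (y - v) - x * (y - v) - (x - u) * y := by ring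
  have h1 : |(x - u) * (y - v)| ≤ δ := by
    rw [abs_mul]; exact (mul_le_mul hu (hv.trans hδ) (abs_nonneg _) hδ0).trans_eq (mul_one _)
  have h2 : |x * (y - v)| ≤ δ := by
    rw [abs_mul]; exact (mul_le_mul hx hv (abs_nonneg _) zero_le_one).trans_eq (one_mul _)
  have h3 : |(x - u) * y| ≤ δ := by
    rw [abs_mul]; exact (mul_le_mul hu hy (abs_nonneg _) hδ0).trans_eq (mul_one _)
  rw [e]
  rw [abs_le] at *
  constructor <;> linarith [h1.1, h1.2, h2.1, h2.2, h3.1, h3.2]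

theorem uniformlySmall_cwTridiag_sub (Γ B : ℝ) {s : ℕ} (hs : s ≤ 1) :
    UniformlySmall fun N => cwTridiag Γ B s N -
      tridiagModel (fun x => cwDiagonal Γ x) (fun x => cwOffDiagonal B x) N := by
  intro ε hε
  set δ := min (ε / (3 * (|B| + 1))) 1
  -- A product of two roots moves by at most 3δ; the cap at 1 absorbs the quadratic term in
  -- `abs_mul_sub_mul_le`.
  have hδ : 0 < δ := by positivity
  have hδ1 : δ ≤ 1 := min_le_right _ _
  have hδB : |B| * (3 * δ) ≤ ε := by
    calc |B| * (3 * δ) ≤ (|B| + 1) * (3 * (ε / (3 * (|B| + 1)))) := by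
          gcongr
          · linarith
          · exact min_le_left _ _
      _ = ε := by field_simp
  filter_upwards [eventually_gt_atTop 0,
    eventually_samplePoint_close (f := fun x => (cwDiagonal Γ x : ℂ))
      (Complex.continuous_ofReal.comp (continuous_cwDiagonal Γ)) hε,
    eventually_samplePoint_close (f := fun x => ((√(1 - x) : ℝ) : ℂ)) (by fun_prop) hδ,
    eventually_samplePoint_close (f := fun x => ((√x : ℝ) : ℂ)) (by fun_prop) hδ]
    with N hN hd hl hr i j
  have hm := samplePoint_mem N i
  have hs' : (s : ℝ) ≤ 1 := by exact_mod_cast hs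
  have hs0 : (0 : ℝ) ≤ s := Nat.cast_nonneg s
  -- The left entry is the case t = s - 1, the right entry the case t = s. Arguments outside [0,1]
  -- are harmless because `√` is continuous on ℝ, being 0 on negatives.
  have off : ∀ t : ℝ, -1 ≤ t → t ≤ 1 →
      |-B * √(1 - ((i : ℝ) + t) / N) * √(((i : ℝ) + (t + 1)) / N) -
        cwOffDiagonal B (samplePoint N i)| ≤ ε := by
    intro t ht1 ht2
    have h1 := hl i _ (abs_samplePoint_sub_div_le hN i ht1 (by linarith))
    have h2 := hr i _ (abs_samplePoint_sub_div_le hN i (t := t + 1) (by linarith) (by linarith))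
    rw [← Complex.ofReal_sub, Complex.norm_real, Real.norm_eq_abs] at h1 h2
    have h3 := abs_mul_sub_mul_le hδ1 (x := √(1 - samplePoint N i)) (y := √(samplePoint N i))
      (by rw [abs_of_nonneg (Real.sqrt_nonneg _)]; exact Real.sqrt_le_one.2 (by linarith [hm.1]))
      (by rw [abs_of_nonneg (Real.sqrt_nonneg _)]; exact Real.sqrt_le_one.2 hm.2) h1 h2
    rw [cwOffDiagonal_of_mem B hm, mul_assoc, ← mul_sub, abs_mul, abs_neg]
    exact (mul_le_mul_of_nonneg_left h3 (abs_nonneg _)).trans hδB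
  simp only [Matrix.sub_apply, cwTridiag, tridiagModel, Matrix.of_apply]
  by_cases h1 : j.val = i.val
  · rw [if_pos h1, if_pos h1, norm_sub_rev]
    have := hd i _ (abs_samplePoint_sub_div_le hN i (t := s) (by linarith) (by linarith))
    rw [mul_div_assoc]
    exact this
  · by_cases h2 : j.val + 1 = i.val
    · rw [if_neg h1, if_neg h1, if_pos h2, if_pos (Or.inl h2), ← Complex.ofReal_sub,
        Complex.norm_real, Real.norm_eq_abs]
      have := off (s - 1) (by linarith) (by linarith)
      rwa [sub_add_cancel, ← add_sub_assoc] at this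
    · by_cases h3 : j.val = i.val + 1
      · rw [if_neg h1, if_neg h1, if_neg h2, if_pos h3, if_pos (Or.inr h3), ← Complex.ofReal_sub,
          Complex.norm_real, Real.norm_eq_abs]
        have := off s (by linarith) (by linarith)
        rwa [← add_assoc] at this
      · rw [if_neg h1, if_neg h1, if_neg h2, if_neg h3, if_neg (by tauto)]
        simpa using hε.le

/-- D·T samples at the row and T·D at the column, so both entries of an off-diagonal pair sample at
the larger index. This makes the matrix Hermitian, and only its upper entries differ from the model.
-/
theorem cwDiagToeplitz_apply (Γ B : ℝ) (N : ℕ) (i j : Fin (N + 1)) :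
    cwDiagToeplitz Γ B N i j = ((if j.val = i.val then cwDiagonal Γ (samplePoint N i)
      else if j.val + 1 = i.val then cwOffDiagonal B (samplePoint N i)
      else if j.val = i.val + 1 then cwOffDiagonal B (samplePoint N j) else 0 : ℝ) : ℂ) := by
  have e : ∀ i : Fin (N + 1), (((i : ℕ) : ℝ) + 1) / ((N + 1 : ℕ) : ℝ) = samplePoint N i := by
    simp [samplePoint]
  have hl : ((i : ℕ) : ℤ) = j + 1 ↔ j.val + 1 = i.val := by omega
  have hr : ((i : ℕ) : ℤ) = j + -1 ↔ j.val = i.val + 1 := by omega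
  simp only [cwDiagToeplitz, Matrix.sub_apply, Matrix.smul_apply, samplingDiag,
    Matrix.diagonal_mul, Matrix.mul_diagonal, e,
    toeplitz_exp_apply (f := fun θ => Complex.exp (Complex.I * θ)) (m := 1) (fun _ => by simp),
    toeplitz_exp_apply (f := fun θ => Complex.exp (-(Complex.I * θ))) (m := -1)
      (fun _ => by simp), hl, hr, smul_eq_mul, Matrix.diagonal_apply,
    cwOffDiagonal_of_mem B (samplePoint_mem N _), cwDiagonal]
  have hij : i = j ↔ j.val = i.val := by rw [Fin.ext_iff, eq_comm]
  simp only [hij]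
  by_cases h1 : j.val = i.val
  · rw [if_pos h1, if_pos h1, if_neg (by omega), if_neg (by omega)]
    push_cast
    ring
  · by_cases h2 : j.val + 1 = i.val
    · rw [if_neg h1, if_neg h1, if_pos h2, if_pos h2, if_neg (by omega)]
      push_cast
      ring
    · by_cases h3 : j.val = i.val + 1
      · rw [if_neg h1, if_neg h1, if_neg h2, if_neg h2, if_pos h3, if_pos h3]
        push_cast
        ring
      · rw [if_neg h1, if_neg h1, if_neg h2, if_neg h2, if_neg h3, if_neg h3]
        simp

theorem isTridiagonal_cwDiagToeplitz (Γ B : ℝ) (N : ℕ) : IsTridiagonal (cwDiagToeplitz Γ B N) := by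
  intro i j h
  rw [cwDiagToeplitz_apply, if_neg (by omega), if_neg (by omega), if_neg (by omega),
    Complex.ofReal_zero]

theorem isHermitian_cwDiagToeplitz (Γ B : ℝ) (N : ℕ) : (cwDiagToeplitz Γ B N).IsHermitian := by
  ext i j
  simp only [Matrix.conjTranspose_apply, cwDiagToeplitz_apply, Complex.star_def,
    Complex.conj_ofReal]
  congr 1
  by_cases h1 : j.val = i.val
  · rw [if_pos h1, if_pos h1.symm, h1]
  · by_cases h2 : j.val + 1 = i.val
    · rw [if_neg h1, if_neg (Ne.symm h1), if_pos h2, if_neg (by omega), if_pos (by omega)]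
    · by_cases h3 : j.val = i.val + 1
      · rw [if_neg h1, if_neg (Ne.symm h1), if_neg h2, if_pos (by omega), if_pos h3]
      · rw [if_neg h1, if_neg (Ne.symm h1), if_neg h2, if_neg h3, if_neg (by omega),
          if_neg (by omega)]

theorem uniformlySmall_cwDiagToeplitz_sub (Γ B : ℝ) :
    UniformlySmall fun N => cwDiagToeplitz Γ B N -
      tridiagModel (fun x => cwDiagonal Γ x) (fun x => cwOffDiagonal B x) N := by
  intro ε hε
  filter_upwards [eventually_samplePoint_close (f := fun x => (cwOffDiagonal B x : ℂ))
      (Complex.continuous_ofReal.comp (continuous_cwOffDiagonal B)) hε] with N hN i j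
  simp only [Matrix.sub_apply, cwDiagToeplitz_apply, tridiagModel, Matrix.of_apply]
  by_cases h1 : j.val = i.val
  · rw [if_pos h1, if_pos h1, sub_self, norm_zero]
    exact hε.le
  · by_cases h2 : j.val + 1 = i.val
    · rw [if_neg h1, if_neg h1, if_pos h2, if_pos (Or.inl h2), sub_self, norm_zero]
      exact hε.le
    · by_cases h3 : j.val = i.val + 1
      · rw [if_neg h1, if_neg h1, if_neg h2, if_pos h3, if_pos (Or.inr h3), norm_sub_rev]
        exact hN i _ (abs_samplePoint_sub_le (mem_neighbours.2 (by omega)))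
      · rw [if_neg h1, if_neg h1, if_neg h2, if_neg h3, if_neg (by tauto)]
        simpa using hε.le

theorem tendsto_spectralNorm_sub {M A A' : ∀ N : ℕ, Matrix (Fin (N + 1)) (Fin (N + 1)) ℂ}
    (hA : ∀ N, IsTridiagonal (A N)) (hA' : ∀ N, IsTridiagonal (A' N))
    (h : UniformlySmall fun N => A N - M N) (h' : UniformlySmall fun N => A' N - M N) :
    Tendsto (fun N => spectralNorm (A N - A' N)) atTop (𝓝 0) := by
  rw [Metric.tendsto_nhds]
  intro ε hε
  filter_upwards [h (ε / 8) (by positivity), h' (ε / 8) (by positivity)] with N h1 h2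
  have h3 : spectralNorm (A N - A' N) ≤ 3 * (ε / 4) := by
    refine ((hA N).sub (hA' N)).spectralNorm_le (by positivity) fun i j => ?_
    have e : (A N - A' N) i j = (A N - M N) i j - (A' N - M N) i j := by
      simp only [Matrix.sub_apply]; ring
    rw [e]
    refine (norm_sub_le _ _).trans ((add_le_add (h1 i j) (h2 i j)).trans_eq ?_)
    ring
  rw [dist_zero_right, Real.norm_eq_abs,
    abs_of_nonneg (show 0 ≤ spectralNorm (A N - A' N) from norm_nonneg _)]
  linarith

theorem isGLTSigmaLambda_curieWeiss (Γ B : ℝ)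
    {A : ∀ N : ℕ, Matrix (Fin (N + 1)) (Fin (N + 1)) ℂ}
    (hA : ∀ N, IsTridiagonal (A N)) (hH : ∀ N, (A N).IsHermitian)
    (hAs : UniformlySmall fun N => A N -
      tridiagModel (fun x => cwDiagonal Γ x) (fun x => cwOffDiagonal B x) N) :
    IsGLTSigmaLambda (fun N => N + 1) A (cwSymbol Γ B) := by
  rw [cwSymbol_eq]
  exact isGLTSigmaLambda_of_isTridiagonal (continuous_cwDiagonal Γ) (continuous_cwOffDiagonal B)
    (by simp [cwOffDiagonal]) (by simp [cwOffDiagonal]) hA hH hAs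

/-! ### Dicke states -/

/-- The number of sites at which a configuration takes the value `1`. -/
def numOnes {N : ℕ} (s : Fin N → Fin 2) : ℕ := (Finset.univ.filter fun x => s x = 1).card

theorem numOnes_le {N : ℕ} (s : Fin N → Fin 2) : numOnes s ≤ N :=
  (Finset.card_filter_le _ _).trans (by simp)

theorem numOnes_comp_perm {N : ℕ} (s : Fin N → Fin 2) (π : Equiv.Perm (Fin N)) :
    numOnes (fun x => s (π x)) = numOnes s := by
  unfold numOnes
  refine Finset.card_bij (fun x _ => π x) (by simp) (by simp) fun y hy => ⟨π.symm y, ?_, by simp⟩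
  simpa using hy

theorem fin_two_eq_of_iff {a b : Fin 2} (h : a = 1 ↔ b = 1) : a = b := by
  revert h; revert a b; decide

/-- A bijection between the two sets of ones extends to a permutation of all sites, so the orbits of
configurations are the level sets of `numOnes`. -/
theorem exists_perm_of_numOnes_eq {N : ℕ} {s t : Fin N → Fin 2} (h : numOnes s = numOnes t) :
    ∃ π : Equiv.Perm (Fin N), (fun x => s (π x)) = t := by
  have hc : Fintype.card {x // t x = 1} = Fintype.card {x // s x = 1} := by
    rw [Fintype.card_subtype, Fintype.card_subtype]
    exact h.symm
  obtain ⟨e⟩ := Fintype.card_eq.1 hc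
  refine ⟨e.extendSubtype, funext fun x => fin_two_eq_of_iff ⟨fun hx => ?_, fun hx => ?_⟩⟩
  · by_contra hne
    exact e.extendSubtype_not_mem x hne hx
  · exact e.extendSubtype_mem x hx

theorem card_numOnes_eq (N k : ℕ) :
    (Finset.univ.filter fun s : Fin N → Fin 2 => numOnes s = k).card = N.choose k := by
  have h : N.choose k = (Finset.powersetCard k (Finset.univ : Finset (Fin N))).card := by simp
  rw [h]
  refine Finset.card_bij' (fun s _ => Finset.univ.filter fun x => s x = 1)
    (fun u _ x => if x ∈ u then 1 else 0) ?_ ?_ ?_ ?_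
  · intro s hs
    exact Finset.mem_powersetCard.2 ⟨Finset.subset_univ _, (Finset.mem_filter.1 hs).2⟩
  · intro u hu
    refine Finset.mem_filter.2 ⟨Finset.mem_univ _, ?_⟩
    simpa [numOnes] using hu
  · intro s _
    funext x
    by_cases hx : s x = 1
    · simp [hx]
    · have : s x = 0 := by omega
      simp [this]
  · intro u _
    ext x
    simp

theorem numOnes_update_one {N : ℕ} {s : Fin N → Fin 2} {x : Fin N} (h : s x = 0) :
    numOnes (Function.update s x 1) = numOnes s + 1 := by
  have e : (Finset.univ.filter fun y => Function.update s x 1 y = 1) =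
      insert x (Finset.univ.filter fun y => s y = 1) := by
    ext y
    by_cases hy : y = x
    · simp [hy]
    · simp [hy]
  rw [numOnes, e, Finset.card_insert_of_notMem (by simp [h])]
  rfl

theorem numOnes_update_zero {N : ℕ} {s : Fin N → Fin 2} {x : Fin N} (h : s x = 1) :
    numOnes (Function.update s x 0) + 1 = numOnes s := by
  rw [← numOnes_update_one (s := Function.update s x 0) (x := x) (by simp),
    Function.update_idem, ← h, Function.update_eq_self]

/-- The amplitude of the Dicke state with `k` ones. -/
noncomputable def dickeAmplitude (N k : ℕ) : ℝ := 1 / √(N.choose k)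

/-- The Dicke state: the normalized sum of the product basis vectors with `k` ones. -/
noncomputable def dickeVector (N k : ℕ) : SpinSpace N :=
  WithLp.toLp 2 fun s => if numOnes s = k then (dickeAmplitude N k : ℂ) else 0

theorem dickeVector_apply (N k : ℕ) (s : Fin N → Fin 2) :
    dickeVector N k s = if numOnes s = k then (dickeAmplitude N k : ℂ) else 0 := rfl

/-- The Dicke state as an element of the symmetric subspace. -/
noncomputable def dickeState (N k : ℕ) : symSubspace N :=
  ⟨dickeVector N k, fun π s => by simp only [dickeVector_apply, numOnes_comp_perm]⟩

/-- Different Dicke states have disjoint supports, and the k-th support consists of N-choose-k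
configurations. -/
theorem orthonormal_dickeState (N : ℕ) :
    Orthonormal ℂ (fun k : Fin (N + 1) => dickeState N k) := by
  rw [orthonormal_iff_ite]
  intro k l
  have hk : 0 < N.choose k := Nat.choose_pos (Nat.lt_succ_iff.1 k.2)
  have e : inner ℂ (dickeState N k) (dickeState N l) =
      ∑ s, inner ℂ (dickeVector N k s) (dickeVector N l s) := rfl
  rw [e]
  simp only [dickeVector_apply]
  by_cases h : k = l
  · subst h
    have e2 : ∀ s : Fin N → Fin 2, inner ℂ (if numOnes s = k then (dickeAmplitude N k : ℂ) else 0)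
        (if numOnes s = k then (dickeAmplitude N k : ℂ) else 0) =
        if numOnes s = k then ((1 / N.choose k : ℝ) : ℂ) else 0 := by
      intro s
      split_ifs
      · rw [RCLike.inner_apply, Complex.conj_ofReal, ← Complex.ofReal_mul, dickeAmplitude,
          div_mul_div_comm, Real.mul_self_sqrt (Nat.cast_nonneg _), one_mul]
      · simp
    rw [Finset.sum_congr rfl fun s _ => e2 s, ← Finset.sum_filter, Finset.sum_const,
      card_numOnes_eq, if_pos rfl]
    have : (N.choose k : ℂ) ≠ 0 := by exact_mod_cast hk.ne'
    simp [this]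
  · rw [if_neg h]
    refine Finset.sum_eq_zero fun s _ => ?_
    by_cases hs : numOnes s = k
    · have : numOnes s ≠ l := fun h2 => h (Fin.ext (hs.symm.trans h2))
      simp [this]
    · simp [hs]

/-- A sample configuration with `k` ones. -/
def initialOnes (N k : ℕ) : Fin N → Fin 2 := fun x => if (x : ℕ) < k then 1 else 0

theorem numOnes_initialOnes {N k : ℕ} (h : k ≤ N) : numOnes (initialOnes N k) = k := by
  have e : ∀ x : Fin N, initialOnes N k x = 1 ↔ (x : ℕ) < k := by
    intro x
    simp [initialOnes]
  simp only [numOnes, e]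
  rw [Fin.card_filter_val_lt, min_eq_right h]

/-- A symmetric vector is constant on each level set of `numOnes`, so its value at one
representative fixes the coefficient; the square root undoes the normalization. -/
theorem span_dickeState (N : ℕ) :
    ⊤ ≤ Submodule.span ℂ (Set.range fun k : Fin (N + 1) => dickeState N k) := by
  rintro ⟨ψ, hψ⟩ -
  have e : (⟨ψ, hψ⟩ : symSubspace N) = ∑ k : Fin (N + 1),
      ((√(N.choose k) : ℝ) * ψ (initialOnes N k)) • dickeState N k := by
    apply Subtype.ext
    ext s
    rw [Submodule.coe_sum, WithLp.ofLp_sum, Finset.sum_apply,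
      Finset.sum_eq_single ⟨numOnes s, Nat.lt_succ_iff.2 (numOnes_le s)⟩]
    · have hk : 0 < N.choose (numOnes s) := Nat.choose_pos (numOnes_le s)
      have hk' : (√(N.choose (numOnes s)) : ℝ) ≠ 0 := by positivity
      obtain ⟨π, hπ⟩ := exists_perm_of_numOnes_eq (numOnes_initialOnes (numOnes_le s))
      have h1 := hψ π (initialOnes N (numOnes s))
      rw [hπ] at h1
      change ψ s = ((√(N.choose (numOnes s)) : ℝ) * ψ (initialOnes N (numOnes s))) *
        dickeVector N (numOnes s) s
      rw [dickeVector_apply, if_pos rfl, dickeAmplitude, h1, mul_right_comm, ← Complex.ofReal_mul,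
        mul_one_div_cancel hk', Complex.ofReal_one, one_mul]
    · intro k _ hk
      have : numOnes s ≠ k := fun h => hk (Fin.ext h.symm)
      change _ * dickeVector N k s = 0
      rw [dickeVector_apply, if_neg this, mul_zero]
    · simp
  rw [e]
  exact Submodule.sum_mem _ fun k _ => Submodule.smul_mem _ _ (Submodule.subset_span ⟨k, rfl⟩)

/-- The orthonormal basis of the symmetric subspace formed by the Dicke states. -/
noncomputable def dickeBasis (N : ℕ) : OrthonormalBasis (Fin (N + 1)) ℂ (symSubspace N) :=
  OrthonormalBasis.mk (orthonormal_dickeState N) (span_dickeState N)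

theorem coe_dickeBasis (N : ℕ) (k : Fin (N + 1)) :
    (dickeBasis N k : SpinSpace N) = dickeVector N k := by
  rw [dickeBasis, OrthonormalBasis.coe_mk]
  rfl

/-! ### Action of the Curie–Weiss Hamiltonian on the Dicke states -/

theorem siteOp_apply {N : ℕ} (P : Matrix (Fin 2) (Fin 2) ℂ) (x : Fin N) (s t : Fin N → Fin 2) :
    siteOp P x s t = ∑ c, if t = Function.update s x c then P (s x) c else 0 := by
  simp only [siteOp, Matrix.of_apply]
  by_cases h : t = Function.update s x (t x)
  · rw [Finset.sum_eq_single (t x) (fun c _ hc => if_neg fun h2 => hc (by rw [h2]; simp))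
      (by simp), if_pos h, Finset.prod_eq_single x]
    · simp
    · intro y _ hy
      have : t y = s y := by rw [h]; simp [hy]
      rw [if_neg hy, this, Matrix.one_apply_eq]
    · simp
  · rw [Finset.sum_eq_zero fun c _ => if_neg fun h2 => h (by rw [h2]; simp)]
    obtain ⟨y, hy⟩ := Function.ne_iff.1 h
    have hyx : y ≠ x := fun hyx => hy (by subst hyx; simp)
    rw [Function.update_of_ne hyx] at hy
    exact Finset.prod_eq_zero (Finset.mem_univ y)
      (by rw [if_neg hyx, Matrix.one_apply_ne (Ne.symm hy)])

theorem siteOp_mulVec {N : ℕ} (P : Matrix (Fin 2) (Fin 2) ℂ) (x : Fin N)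
    (ψ : (Fin N → Fin 2) → ℂ) (s : Fin N → Fin 2) :
    (siteOp P x).mulVec ψ s = ∑ c, P (s x) c * ψ (Function.update s x c) := by
  simp only [Matrix.mulVec, dotProduct, siteOp_apply, Finset.sum_mul, ite_mul, zero_mul]
  rw [Finset.sum_comm]
  simp

theorem siteOp_pauli₃_mulVec {N : ℕ} (x : Fin N) (ψ : (Fin N → Fin 2) → ℂ) (s : Fin N → Fin 2) :
    (siteOp pauli₃ x).mulVec ψ s = (if s x = 1 then -1 else 1) * ψ s := by
  have h : s x = 0 ∨ s x = 1 := by omega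
  have hu := Function.update_eq_self x s
  rw [siteOp_mulVec, Fin.sum_univ_two]
  rcases h with h | h <;> rw [h] at hu ⊢ <;> simp [pauli₃, hu]

theorem siteOp_pauli₁_mulVec {N : ℕ} (x : Fin N) (ψ : (Fin N → Fin 2) → ℂ) (s : Fin N → Fin 2) :
    (siteOp pauli₁ x).mulVec ψ s = ψ (Function.update s x (if s x = 1 then 0 else 1)) := by
  have h : s x = 0 ∨ s x = 1 := by omega
  rw [siteOp_mulVec, Fin.sum_univ_two]
  rcases h with h | h <;> rw [h] <;> simp [pauli₁]

theorem sum_sign_eq {N : ℕ} (s : Fin N → Fin 2) :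
    ∑ x, (if s x = 1 then (-1 : ℂ) else 1) = N - 2 * numOnes s := by
  have e : ∀ x, (if s x = 1 then (-1 : ℂ) else 1) = 1 - 2 * (if s x = 1 then 1 else 0) := by
    intro x; split_ifs <;> ring
  simp only [e, Finset.sum_sub_distrib, ← Finset.mul_sum, Finset.sum_boole, numOnes]
  simp

/-- The σ₃ operators are diagonal, so their double sum is the square of the total sign N - 2k, where
k is the number of ones. -/
theorem cwHamiltonian_mulVec (Γ B : ℝ) (N : ℕ) (ψ : (Fin N → Fin 2) → ℂ) (s : Fin N → Fin 2) :
    (cwHamiltonian Γ B N).mulVec ψ s = -(Γ / (2 * N)) * ((N - 2 * numOnes s) ^ 2 * ψ s) -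
      B * ∑ x, ψ (Function.update s x (if s x = 1 then 0 else 1)) := by
  simp only [cwHamiltonian, Matrix.sub_mulVec, Matrix.smul_mulVec, Matrix.sum_mulVec,
    ← Matrix.mulVec_mulVec, Pi.sub_apply, Pi.smul_apply, Finset.sum_apply, smul_eq_mul,
    siteOp_pauli₃_mulVec, siteOp_pauli₁_mulVec]
  congr 2
  rw [← sum_sign_eq, sq, Finset.sum_mul_sum, Finset.sum_mul]
  refine Finset.sum_congr rfl fun x _ => ?_
  rw [Finset.sum_mul]
  exact Finset.sum_congr rfl fun y _ => by ring

/-- Of the N single-spin flips of s, `numOnes s` lower the number of ones by one and the remaining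
flips raise it by one. -/
theorem sum_dickeVector_flip (N j : ℕ) (s : Fin N → Fin 2) :
    ∑ x, dickeVector N j (Function.update s x (if s x = 1 then 0 else 1)) =
      (if j + 1 = numOnes s then (numOnes s : ℂ) * dickeAmplitude N j else 0) +
      (if j = numOnes s + 1 then ((N : ℂ) - numOnes s) * dickeAmplitude N j else 0) := by
  have e : ∀ x, dickeVector N j (Function.update s x (if s x = 1 then 0 else 1)) =
      (if s x = 1 then 1 else 0) * (if j + 1 = numOnes s then (dickeAmplitude N j : ℂ) else 0) +
      (1 - if s x = 1 then 1 else 0) *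
        (if j = numOnes s + 1 then (dickeAmplitude N j : ℂ) else 0) := by
    intro x
    rw [dickeVector_apply]
    by_cases hx : s x = 1
    · have h := numOnes_update_zero hx
      rw [if_pos hx, if_pos hx]
      simp only [one_mul, sub_self, zero_mul, add_zero]
      exact if_congr (by omega) rfl rfl
    · have h := numOnes_update_one (s := s) (x := x) (by omega)
      rw [if_neg hx, if_neg hx, h]
      simp only [zero_mul, zero_add, sub_zero, one_mul]
      exact if_congr (by omega) rfl rfl
  have hc : ∑ x, (if s x = 1 then (1 : ℂ) else 0) = numOnes s := by
    simp only [Finset.sum_boole, numOnes]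
  rw [Finset.sum_congr rfl fun x _ => e x, Finset.sum_add_distrib, ← Finset.sum_mul,
    ← Finset.sum_mul, Finset.sum_sub_distrib, hc]
  simp

/-- Both identities are C(N,k+1)(k+1) = C(N,k)(N-k) after taking square roots. They turn the unequal
flip counts k+1 and N-k into the same symmetric off-diagonal entry. -/
theorem dickeAmplitude_ratio {N k : ℕ} (hk : k < N) :
    ((k : ℝ) + 1) / N * dickeAmplitude N k =
        √(1 - (k : ℝ) / N) * √(((k : ℝ) + 1) / N) * dickeAmplitude N (k + 1) ∧
      ((N : ℝ) - k) / N * dickeAmplitude N (k + 1) =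
        √(1 - (k : ℝ) / N) * √(((k : ℝ) + 1) / N) * dickeAmplitude N k := by
  have hN : (0 : ℝ) < N := by exact_mod_cast (Nat.zero_le k).trans_lt hk
  have hkN : (0 : ℝ) < (N : ℝ) - k := sub_pos.2 (by exact_mod_cast hk)
  have h1 : (0 : ℝ) < N.choose k := by exact_mod_cast Nat.choose_pos hk.le
  have h2 : (0 : ℝ) < N.choose (k + 1) := by exact_mod_cast Nat.choose_pos hk
  have hrec : (N.choose (k + 1) : ℝ) * ((k : ℝ) + 1) = N.choose k * ((N : ℝ) - k) := by
    have := Nat.choose_succ_right_eq N k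
    rw [← Nat.cast_sub hk.le]
    exact_mod_cast this
  have e1 : √(1 - (k : ℝ) / N) = √((N : ℝ) - k) / √N := by
    rw [← Real.sqrt_div hkN.le]
    congr 1
    field_simp
  have e2 : √(((k : ℝ) + 1) / N) = √((k : ℝ) + 1) / √N := Real.sqrt_div (by positivity) _
  have key : √(N.choose (k + 1)) * √((k : ℝ) + 1) = √(N.choose k) * √((N : ℝ) - k) := by
    rw [← Real.sqrt_mul h2.le, ← Real.sqrt_mul h1.le, hrec]
  have hc := Real.sqrt_pos.2 h1
  have hd := Real.sqrt_pos.2 h2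
  have sN := Real.mul_self_sqrt hN.le
  have sk := Real.mul_self_sqrt (show (0 : ℝ) ≤ (k : ℝ) + 1 by positivity)
  have sNk := Real.mul_self_sqrt hkN.le
  have hsN := Real.sqrt_pos.2 hN
  rw [e1, e2, dickeAmplitude, dickeAmplitude]
  set a := √((k : ℝ) + 1)
  set b := √((N : ℝ) - k)
  set c := √(N.choose k : ℝ)
  set d := √(N.choose (k + 1) : ℝ)
  set n := √(N : ℝ)
  -- With k+1, N-k and N written as squares of their roots, both claims are rational identities that
  -- follow from `key`.
  rw [← sk, ← sNk, ← sN]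
  constructor
  · field_simp
    linear_combination a * key
  · field_simp
    linear_combination -b * key

/-- Evaluated at a configuration s, the right-hand sum keeps only the Dicke state with `numOnes s`
ones, so the row index of the matrix is the number of ones. -/
theorem cwHamiltonian_dickeBasis (Γ B : ℝ) {N : ℕ} (hN : 1 ≤ N) (j : Fin (N + 1)) :
    Matrix.toEuclideanLin ((1 / (N : ℂ)) • cwHamiltonian Γ B N) (dickeBasis N j : SpinSpace N) =
      ∑ i, cwTridiag Γ B 0 N i j • (dickeBasis N i : SpinSpace N) := by
  have hN0 : (N : ℂ) ≠ 0 := by exact_mod_cast (by omega : N ≠ 0)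
  simp only [coe_dickeBasis]
  ext s
  have hk := numOnes_le s
  have hr : (∑ i : Fin (N + 1), cwTridiag Γ B 0 N i j • dickeVector N i) s =
      cwTridiag Γ B 0 N ⟨numOnes s, Nat.lt_succ_iff.2 hk⟩ j * dickeAmplitude N (numOnes s) := by
    rw [WithLp.ofLp_sum, Finset.sum_apply,
      Finset.sum_eq_single ⟨numOnes s, Nat.lt_succ_iff.2 hk⟩]
    · change _ * dickeVector N (numOnes s) s = _
      rw [dickeVector_apply, if_pos rfl]
    · intro i _ hi
      have : numOnes s ≠ i := fun h => hi (Fin.ext h.symm)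
      change _ * dickeVector N i s = 0
      rw [dickeVector_apply, if_neg this, mul_zero]
    · simp
  have hl : Matrix.toEuclideanLin ((1 / (N : ℂ)) • cwHamiltonian Γ B N) (dickeVector N j) s =
      (1 / (N : ℂ)) * (cwHamiltonian Γ B N).mulVec (dickeVector N j) s := by
    change (((1 / (N : ℂ)) • cwHamiltonian Γ B N).mulVec (dickeVector N j)) s = _
    rw [Matrix.smul_mulVec]
    rfl
  rw [hr, hl, cwHamiltonian_mulVec, sum_dickeVector_flip, dickeVector_apply]
  simp only [cwTridiag, Matrix.of_apply, Nat.cast_zero, add_zero]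
  set k := numOnes s
  by_cases h1 : j.val = k
  · rw [if_pos h1, if_pos h1.symm, if_neg (by omega), if_neg (by omega), h1]
    push_cast
    field_simp
    ring
  · by_cases h2 : j.val + 1 = k
    · have h := congrArg (fun r : ℝ => (r : ℂ)) (dickeAmplitude_ratio (N := N) (k := j) (by omega)).1
      have hk1 : (k : ℝ) = j + 1 := by exact_mod_cast h2.symm
      rw [if_neg h1, if_neg (Ne.symm h1), if_pos h2, if_pos h2, if_neg (by omega), ← h2]
      push_cast at h ⊢
      rw [add_sub_cancel_right]
      linear_combination (-B : ℂ) * h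
    · by_cases h3 : j.val = k + 1
      · have h := congrArg (fun r : ℝ => (r : ℂ))
          (dickeAmplitude_ratio (N := N) (k := k) (by omega)).2
        rw [if_neg h1, if_neg (Ne.symm h1), if_neg h2, if_neg h2, if_pos h3, if_pos h3, h3]
        push_cast at h ⊢
        linear_combination (-B : ℂ) * h
      · rw [if_neg h1, if_neg (Ne.symm h1), if_neg h2, if_neg h2, if_neg h3, if_neg h3]
        simp

end CurieWeissGLT

/-- The first clause contains the dimension, through the index type of the basis, and the
invariance, since each image is expanded in the basis. -/
theorem mainTheorem5 (Γ B : ℝ) :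
    -- in an orthonormal basis of the symmetric subspace, the normalized Curie–Weiss Hamiltonian
    -- acts as the tridiagonal matrix with rows labelled by `0, …, N`
    (∀ N : ℕ, 1 ≤ N →
      ∃ b : OrthonormalBasis (Fin (N + 1)) ℂ (CurieWeissGLT.symSubspace N),
        ∀ j : Fin (N + 1),
          Matrix.toEuclideanLin ((1 / (N : ℂ)) • CurieWeissGLT.cwHamiltonian Γ B N)
              (b j : CurieWeissGLT.SpinSpace N)
            = ∑ i, CurieWeissGLT.cwTridiag Γ B 0 N i j • (b i : CurieWeissGLT.SpinSpace N)) ∧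
    -- comparison with the diagonal-sampling/Toeplitz expression, for both labellings of the rows
    -- (by `0, …, N` and by `1, …, N + 1`)
    (∀ s : ℕ, s ≤ 1 →
      Tendsto
        (fun N => CurieWeissGLT.spectralNorm
          (CurieWeissGLT.cwTridiag Γ B s N - CurieWeissGLT.cwDiagToeplitz Γ B N))
        atTop (𝓝 0)) ∧
    -- GLT symbol, singular value distribution, eigenvalue distribution
    (∀ s : ℕ, s ≤ 1 →
      CurieWeissGLT.IsGLTSigmaLambda (fun N => N + 1) (fun N => CurieWeissGLT.cwTridiag Γ B s N)
        (CurieWeissGLT.cwSymbol Γ B)) ∧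
    CurieWeissGLT.IsGLTSigmaLambda (fun N => N + 1)
      (fun N => CurieWeissGLT.cwDiagToeplitz Γ B N) (CurieWeissGLT.cwSymbol Γ B) := by
  have ht := CurieWeissGLT.isTridiagonal_cwTridiag Γ B
  have hK := CurieWeissGLT.isTridiagonal_cwDiagToeplitz Γ B
  have hKs := CurieWeissGLT.uniformlySmall_cwDiagToeplitz_sub Γ B
  refine ⟨fun N hN => ⟨CurieWeissGLT.dickeBasis N, fun j =>
      CurieWeissGLT.cwHamiltonian_dickeBasis Γ B hN j⟩, fun s hs => ?_, fun s hs => ?_, ?_⟩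
  · exact CurieWeissGLT.tendsto_spectralNorm_sub (ht s) hK
      (CurieWeissGLT.uniformlySmall_cwTridiag_sub Γ B hs) hKs
  · exact CurieWeissGLT.isGLTSigmaLambda_curieWeiss Γ B (ht s)
      (CurieWeissGLT.isHermitian_cwTridiag Γ B s)
      (CurieWeissGLT.uniformlySmall_cwTridiag_sub Γ B hs)
  · exact CurieWeissGLT.isGLTSigmaLambda_curieWeiss Γ B hK
      (CurieWeissGLT.isHermitian_cwDiagToeplitz Γ B) hKs
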